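/- Theorem (Laplace single-layer potential on curves). Let $a>0$, let $\rho:\mathbb{R}\to\mathbb{R}^n$ be a $C^\infty$, $2a$-periodic function parameterizing a closed curve, with $\rho'(0)\neq 0$ and $\rho(x)\neq\rho(0)$ for $0<|x|\le a$ (for instance, any regular parameterization of a smooth simple closed curve). Let $\tau$ be a real- or complex-valued $2a$-periodic density (a density on the curve, written as a function of the parameter) such that $\tilde\tau(x):=\tau(x)\,|\rho'(x)|$ is $C^\infty$. Put $r(x):=|\rho(0)-\rho(x)|$ and $s(x):=-\log r(x)$. For an integer $M\ge 1$ let $h=a/(M+\tfrac12)$, and let $$T_h^0[g]=\sum_{\substack{m=-M\\ m\neq 0}}^{M} g(mh)\,h$$ be the punctured trapezoidal rule on $[-a,a]$. Let $K\ge 0$ be an integer. Then the linear system $$\sum_{j=0}^{K} w_j\, j^{2k} = -\zeta'(-2k),\qquad k=0,1,\dots,K \quad(0^0:=1),$$ where $\zeta$ is the Riemann zeta function, has exactly one real solution $(w_0,\dots,w_K)$, the function $s\,\tilde\tau$ is integrable on $[-a,a]$, and $$\int_{-a}^{a}\bigl(-\log r(x)\bigr)\,\tau(x)\,|\rho'(x)|\,dx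 = T_h^0[s\cdot\tilde\tau]-\tilde\tau(0)\,h\log\bigl(|\rho'(0)|\,h\bigr)+h\sum_{j=0}^{K}w_j\bigl(\tilde\tau(jh)+\tilde\tau(-jh)\bigr)+O(h^{2K+2})$$ as $M\to\infty$ (that is, as $h=a/(M+\tfrac12)\to 0^+$), where the implied constant may depend on $a$, $\rho$, $\tau$ and $K$ but not on $M$. -/

import Mathlib

open scoped ContDiff Topology

noncomputable section

/-- The step `h = a / (M + 1/2)` of the grid `x_n = n h`, `n = -M, …, M`, on `[-a, a]`. -/
def gridStep (a : ℝ) (M : ℕ) : ℝ := a / ((M : ℝ) + 1 / 2)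

/-- The punctured trapezoidal rule `∑' g(n h) h` over `n = -M, …, M` with `n = 0` omitted. -/
def puncturedTrapezoid {F : Type*} [AddCommGroup F] [Module ℝ F]
    (a : ℝ) (M : ℕ) (g : ℝ → F) : F :=
  ∑ n ∈ (Finset.Icc (-(M : ℤ)) (M : ℤ)).erase 0,
    gridStep a M • g ((n : ℝ) * gridStep a M)

/-- `w_0, …, w_K` solve `∑_{j=0}^K w_j j^{2k} = -ζ'(-2k)` for `k = 0, …, K` (with `0^0 = 1`). -/
def IsLogCorrectionWeights (K : ℕ) (w : Fin (K + 1) → ℝ) : Prop :=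
  ∀ k : ℕ, k ≤ K →
    ∑ j : Fin (K + 1), (w j : ℂ) * ((j : ℕ) : ℂ) ^ (2 * k) =
      -deriv riemannZeta (-(2 * (k : ℂ)))

/-- The distance `r(x) = |ρ(0) - ρ(x)|` from the target point. -/
def targetDist {n : ℕ} (ρ : ℝ → EuclideanSpace ℝ (Fin n)) (x : ℝ) : ℝ := ‖ρ 0 - ρ x‖

/-- The density times the arc length element, `τ(x) |ρ'(x)|`. -/
def weightedDensity {n : ℕ} {𝕜 : Type*} [RCLike 𝕜]
    (ρ : ℝ → EuclideanSpace ℝ (Fin n)) (τ : ℝ → 𝕜) (x : ℝ) : 𝕜 :=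
  ‖deriv ρ x‖ • τ x

/-- The integrand `-log r(x) τ(x) |ρ'(x)|` of the Laplace single-layer potential. -/
def laplaceIntegrand {n : ℕ} {𝕜 : Type*} [RCLike 𝕜]
    (ρ : ℝ → EuclideanSpace ℝ (Fin n)) (τ : ℝ → 𝕜) (x : ℝ) : 𝕜 :=
  (-Real.log (targetDist ρ x)) • weightedDensity ρ τ x

/-- The Laplace single-layer potential of `τ` at the target point `ρ(0)`. -/
def laplaceSLP {n : ℕ} {𝕜 : Type*} [RCLike 𝕜] (a : ℝ)
    (ρ : ℝ → EuclideanSpace ℝ (Fin n)) (τ : ℝ → 𝕜) : 𝕜 :=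
  ∫ x in (-a)..a, laplaceIntegrand ρ τ x

/-- The corrected trapezoidal rule: the punctured rule, minus `τ̃(0) h log(|ρ'(0)| h)`, plus
`h ∑_{j=0}^K w_j (τ̃(jh) + τ̃(-jh))`, where `τ̃ = τ |ρ'|`. -/
def correctedRule {n : ℕ} {𝕜 : Type*} [RCLike 𝕜] (a : ℝ)
    (ρ : ℝ → EuclideanSpace ℝ (Fin n)) (τ : ℝ → 𝕜) {K : ℕ} (w : Fin (K + 1) → ℝ)
    (M : ℕ) : 𝕜 :=
  puncturedTrapezoid a M (laplaceIntegrand ρ τ)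
    - (gridStep a M * Real.log (‖deriv ρ 0‖ * gridStep a M)) • weightedDensity ρ τ 0
    + gridStep a M • ∑ j : Fin (K + 1), w j •
        (weightedDensity ρ τ ((j : ℕ) * gridStep a M)
          + weightedDensity ρ τ (-((j : ℕ) * gridStep a M)))

end

section

open Filter Finset

theorem deriv_riemannZeta_neg_two_mul (k : ℕ) (hk : k ≠ 0) :
    deriv riemannZeta (-(2 * (k : ℂ))) =
      (-1) ^ k * (2 * k).factorial / (2 * (2 * (Real.pi : ℂ)) ^ (2 * k))
        * riemannZeta (2 * k + 1) := by
  set s₀ : ℂ := 2 * k + 1 with hs₀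
  have hne : s₀ ≠ 1 := by simp [hs₀, hk]
  have hpos : 0 < s₀.re := by simp [hs₀]; positivity
  have hleft : HasDerivAt (fun s : ℂ => riemannZeta (1 - s))
      (-deriv riemannZeta (-(2 * (k : ℂ)))) s₀ := by
    have h1 : (1 : ℂ) - s₀ = -(2 * (k : ℂ)) := by simp [hs₀]
    have h2 : HasDerivAt riemannZeta (deriv riemannZeta (-(2 * (k : ℂ)))) (1 - s₀) := by
      rw [← h1]
      refine (differentiableAt_riemannZeta ?_).hasDerivAt
      rw [h1]
      intro h
      have := congrArg Complex.re h
      simp at this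
      linarith [(Nat.cast_nonneg k : (0 : ℝ) ≤ k)]
    have h3 := h2.comp s₀ ((hasDerivAt_id s₀).const_sub 1)
    rw [mul_neg_one] at h3
    exact h3
  have hA : DifferentiableAt ℂ
      (fun s : ℂ => 2 * (2 * (Real.pi : ℂ)) ^ (-s) * Complex.Gamma s * riemannZeta s) s₀ := by
    have h2pi : (2 * (Real.pi : ℂ)) ≠ 0 := by simp [Real.pi_ne_zero]
    refine DifferentiableAt.mul (DifferentiableAt.mul ?_ ?_) (differentiableAt_riemannZeta hne)
    · exact (DifferentiableAt.const_cpow differentiableAt_id.neg (Or.inl h2pi)).const_mul 2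
    · refine Complex.differentiableAt_Gamma _ fun m h => ?_
      rw [h] at hpos
      simp at hpos
      linarith [(Nat.cast_nonneg m : (0 : ℝ) ≤ m)]
  have harg : (Real.pi : ℂ) * s₀ / 2 = k * Real.pi + Real.pi / 2 := by
    rw [hs₀]; ring
  have hcos0 : Complex.cos (Real.pi * s₀ / 2) = 0 := by
    rw [harg, Complex.cos_add_pi_div_two, Complex.sin_nat_mul_pi, neg_zero]
  have hsin : Complex.sin (Real.pi * s₀ / 2) = (-1) ^ k := by
    rw [harg, Complex.sin_add_pi_div_two]
    exact_mod_cast congrArg (fun x : ℝ => (x : ℂ)) (Real.cos_nat_mul_pi k)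
  have hcos : HasDerivAt (fun s : ℂ => Complex.cos (Real.pi * s / 2))
      (-Complex.sin (Real.pi * s₀ / 2) * (Real.pi / 2)) s₀ := by
    refine (Complex.hasDerivAt_cos _).comp s₀ ?_
    simpa using ((hasDerivAt_id s₀).const_mul (Real.pi : ℂ)).div_const 2
  have hright := hA.hasDerivAt.mul hcos
  rw [hcos0, hsin, mul_zero, zero_add] at hright
  have heq : (fun s : ℂ => riemannZeta (1 - s)) =ᶠ[𝓝 s₀]
      ((fun s : ℂ => 2 * (2 * (Real.pi : ℂ)) ^ (-s) * Complex.Gamma s * riemannZeta s) *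
        fun s : ℂ => Complex.cos (Real.pi * s / 2)) := by
    have hopen : {s : ℂ | 0 < s.re} ∈ 𝓝 s₀ :=
      (isOpen_lt continuous_const Complex.continuous_re).mem_nhds hpos
    filter_upwards [hopen, isOpen_ne.mem_nhds hne] with s hs hs1
    rw [riemannZeta_one_sub _ hs1]
    · simp only [Pi.mul_apply]; ring
    · intro m h
      simp only [h, Complex.neg_re, Complex.natCast_re] at hs
      linarith [(Nat.cast_nonneg m : (0 : ℝ) ≤ m)]
  have hmain := hleft.unique (hright.congr_of_eventuallyEq heq)
  have hG : Complex.Gamma s₀ = (2 * k).factorial := by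
    rw [hs₀]; exact_mod_cast Complex.Gamma_nat_eq_factorial (2 * k)
  have hp : (2 * (Real.pi : ℂ)) ^ (-s₀) = ((2 * (Real.pi : ℂ)) ^ (2 * k + 1))⁻¹ := by
    rw [Complex.cpow_neg, hs₀]
    congr 1
    exact_mod_cast Complex.cpow_natCast (2 * (Real.pi : ℂ)) (2 * k + 1)
  rw [hG, hp] at hmain
  rw [← neg_neg (deriv riemannZeta _), hmain]
  have hpi : (Real.pi : ℂ) ≠ 0 := by simp [Real.pi_ne_zero]
  field_simp
  ring

/-- The sum `∑_{q ≥ 1} q^{-(2k+1)}`. -/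
noncomputable def oddZeta (k : ℕ) : ℝ := ∑' q : ℕ, 1 / ((q : ℝ) + 1) ^ (2 * k + 1)

theorem riemannZeta_two_mul_add_one (k : ℕ) (hk : k ≠ 0) :
    riemannZeta (2 * k + 1) = (oddZeta k : ℂ) := by
  rw [zeta_eq_tsum_one_div_nat_add_one_cpow, oddZeta, Complex.ofReal_tsum]
  · refine tsum_congr fun q => ?_
    push_cast
    congr 1
    exact_mod_cast Complex.cpow_natCast ((q : ℂ) + 1) (2 * k + 1)
  · simpa using Nat.pos_of_ne_zero hk

/-- The numbers `-ζ'(-2k)`, in closed form. -/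
noncomputable def logCorrectionMoment (k : ℕ) : ℝ :=
  if k = 0 then Real.log (2 * Real.pi) / 2 else
    -((-1) ^ k * (2 * k).factorial / (2 * (2 * Real.pi) ^ (2 * k)) * oddZeta k)

theorem ofReal_logCorrectionMoment (k : ℕ) :
    (logCorrectionMoment k : ℂ) = -deriv riemannZeta (-(2 * (k : ℂ))) := by
  rcases eq_or_ne k 0 with rfl | hk
  · have h : -(2 * ((0 : ℕ) : ℂ)) = 0 := by simp
    rw [h, deriv_riemannZeta_zero, logCorrectionMoment, if_pos rfl]
    have h2 : (2 * (Real.pi : ℂ)) = ((2 * Real.pi : ℝ) : ℂ) := by push_cast; rfl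
    rw [h2, ← Complex.ofReal_log (by positivity)]
    push_cast; ring
  · rw [deriv_riemannZeta_neg_two_mul k hk, riemannZeta_two_mul_add_one k hk, logCorrectionMoment,
      if_neg hk]
    push_cast; ring

theorem isLogCorrectionWeights_iff {K : ℕ} {w : Fin (K + 1) → ℝ} :
    IsLogCorrectionWeights K w ↔
      ∀ k : Fin (K + 1), ∑ j : Fin (K + 1), w j * (j : ℝ) ^ (2 * (k : ℕ)) =
        logCorrectionMoment k := by
  have key (k : ℕ) : (∑ j : Fin (K + 1), (w j : ℂ) * ((j : ℕ) : ℂ) ^ (2 * k) =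
      -deriv riemannZeta (-(2 * (k : ℂ)))) ↔
      ∑ j : Fin (K + 1), w j * (j : ℝ) ^ (2 * k) = logCorrectionMoment k := by
    rw [← ofReal_logCorrectionMoment]
    exact_mod_cast Iff.rfl
  constructor
  · exact fun h k => (key k).1 (h k (Nat.lt_succ_iff.1 k.2))
  · exact fun h k hk => (key k).2 (h ⟨k, Nat.lt_succ_iff.2 hk⟩)

theorem existsUnique_isLogCorrectionWeights (K : ℕ) :
    ∃! w : Fin (K + 1) → ℝ, IsLogCorrectionWeights K w := by
  set V : Matrix (Fin (K + 1)) (Fin (K + 1)) ℝ :=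
    (Matrix.vandermonde fun j : Fin (K + 1) => (j : ℝ) ^ 2).transpose with hV
  have hdet : IsUnit V.det := by
    rw [hV, Matrix.det_transpose, isUnit_iff_ne_zero, Matrix.det_vandermonde_ne_zero_iff]
    intro i j hij
    have := (pow_left_inj₀ (Nat.cast_nonneg _) (Nat.cast_nonneg _) two_ne_zero).1 hij
    exact Fin.ext (by exact_mod_cast this)
  have hiff (w : Fin (K + 1) → ℝ) : IsLogCorrectionWeights K w ↔
      V.mulVec w = fun k : Fin (K + 1) => logCorrectionMoment k := by
    rw [isLogCorrectionWeights_iff, funext_iff]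
    refine forall_congr' fun k => ?_
    simp only [hV, Matrix.mulVec, dotProduct, Matrix.transpose_apply, Matrix.vandermonde_apply,
      ← pow_mul, mul_comm]
  have hinv : IsUnit V := (Matrix.isUnit_iff_isUnit_det V).2 hdet
  obtain ⟨w, hw⟩ := (Matrix.mulVec_surjective_iff_isUnit.2 hinv)
    (fun k : Fin (K + 1) => logCorrectionMoment k)
  exact ⟨w, (hiff w).2 hw, fun w' hw' =>
    Matrix.mulVec_injective_iff_isUnit.2 hinv (((hiff w').1 hw').trans hw.symm)⟩

/-- The periodic logarithmic kernel `-log |2 sin πt|`. -/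
noncomputable def logKernel (t : ℝ) : ℝ := -Real.log (2 * Real.sin (Real.pi * t))

/-- The symmetric punctured index set `{-M, …, M} \ {0}`. -/
noncomputable abbrev puncturedIndices (M : ℕ) : Finset ℤ := (Icc (-(M : ℤ)) (M : ℤ)).erase 0

theorem tendsto_sum_pow_div_neg_log {z : ℂ} (hz : ‖z‖ = 1) (hz1 : z ≠ 1) :
    Tendsto (fun n => ∑ i ∈ range n, z ^ (i + 1) / ((i : ℂ) + 1)) atTop
      (𝓝 (-Complex.log (1 - z))) := by
  have hz' : z - 1 ≠ 0 := sub_ne_zero.2 hz1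
  have hcauchy : CauchySeq fun n => ∑ i ∈ range n, z ^ (i + 1) / ((i : ℂ) + 1) := by
    have hanti : Antitone fun i : ℕ => 1 / ((i : ℝ) + 1) := fun i j hij =>
      one_div_le_one_div_of_le (by positivity) (by gcongr)
    have hb (n : ℕ) : ‖∑ i ∈ range n, z ^ (i + 1)‖ ≤ 2 / ‖z - 1‖ := by
      have : ∑ i ∈ range n, z ^ (i + 1) = z * ((z ^ n - 1) / (z - 1)) := by
        rw [← geom_sum_eq hz1, mul_sum]
        exact sum_congr rfl fun i _ => pow_succ' z i
      rw [this, norm_mul, hz, one_mul, norm_div]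
      gcongr
      calc ‖z ^ n - 1‖ ≤ ‖z ^ n‖ + ‖(1 : ℂ)‖ := norm_sub_le _ _
        _ = 2 := by rw [norm_pow, hz]; norm_num
    convert hanti.cauchySeq_series_mul_of_tendsto_zero_of_bounded
      tendsto_one_div_add_atTop_nhds_zero_nat hb using 4 with n i
    rw [Complex.real_smul]; push_cast; ring
  obtain ⟨l, hl⟩ := cauchySeq_tendsto_of_complete hcauchy
  have habel := Complex.tendsto_tsum_powerSeries_nhdsWithin_lt hl
  have hid : Tendsto (fun x : ℝ => (x : ℂ)) (𝓝[<] 1) (𝓝 1) :=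
    (Complex.continuous_ofReal.tendsto' 1 1 Complex.ofReal_one).mono_left nhdsWithin_le_nhds
  have hre : 0 < (1 - z).re := by
    have h1 : z.re < 1 := by
      refine lt_of_le_of_ne ((Complex.re_le_norm z).trans_eq hz) fun h => hz1 ?_
      have h2 := Complex.sq_norm z
      rw [hz, Complex.normSq_apply, h] at h2
      have him : z.im = 0 := by nlinarith
      exact Complex.ext h him
    simpa using h1
  have hlog : Tendsto (fun x : ℝ => -Complex.log (1 - x * z)) (𝓝[<] 1)
      (𝓝 (-Complex.log (1 - z))) := by
    have h := (tendsto_const_nhds (x := (1 : ℂ))).sub (hid.mul (tendsto_const_nhds (x := z)))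
    rw [one_mul] at h
    exact ((continuousAt_clog (Or.inl hre)).tendsto.comp h).neg
  have heq : (fun x : ℝ => -Complex.log (1 - x * z)) =ᶠ[𝓝[<] 1]
      fun x : ℝ => (x : ℂ) * ∑' n : ℕ, z ^ (n + 1) / ((n : ℂ) + 1) * (x : ℂ) ^ n := by
    filter_upwards [Ioo_mem_nhdsLT (zero_lt_one : (0 : ℝ) < 1)] with x hx
    have hn : ‖(x : ℂ) * z‖ < 1 := by
      rw [norm_mul, hz, mul_one, Complex.norm_real, Real.norm_of_nonneg hx.1.le]; exact hx.2
    rw [← (Complex.hasSum_taylorSeries_neg_log' hn).tsum_eq, ← tsum_mul_left]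
    exact tsum_congr fun n => by ring
  have h1 := hid.mul habel
  rw [one_mul] at h1
  have := tendsto_nhds_unique (h1.congr' heq.symm) hlog
  rwa [this] at hl

theorem norm_one_sub_exp (t : ℝ) :
    ‖1 - Complex.exp (2 * Real.pi * t * Complex.I)‖ = |2 * Real.sin (Real.pi * t)| := by
  have h := Complex.norm_exp_I_mul_ofReal_sub_one (2 * Real.pi * t)
  rw [norm_sub_rev, show 2 * (Real.pi : ℂ) * t * Complex.I
    = Complex.I * ((2 * Real.pi * t : ℝ) : ℂ) by push_cast; ring, h, Real.norm_eq_abs]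
  congr 3; ring

theorem tendsto_sum_cos_div_logKernel {t : ℝ} (ht : Real.sin (Real.pi * t) ≠ 0) :
    Tendsto (fun n => ∑ i ∈ range n, Real.cos (2 * Real.pi * (i + 1) * t) / ((i : ℝ) + 1)) atTop
      (𝓝 (logKernel t)) := by
  set z := Complex.exp (2 * Real.pi * t * Complex.I) with hz
  have hnorm : ‖z‖ = 1 := by
    rw [hz]; exact_mod_cast Complex.norm_exp_ofReal_mul_I (2 * Real.pi * t)
  have hne : z ≠ 1 := by
    intro h
    have := norm_one_sub_exp t
    rw [← hz, h, sub_self, norm_zero, eq_comm, abs_eq_zero] at this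
    exact ht (by linarith)
  have h := (Complex.continuous_re.tendsto _).comp (tendsto_sum_pow_div_neg_log hnorm hne)
  rw [Complex.neg_re, Complex.log_re, hz, norm_one_sub_exp, Real.log_abs] at h
  refine h.congr fun n => ?_
  simp only [Function.comp_apply, Complex.re_sum]
  refine sum_congr rfl fun i _ => ?_
  rw [← Complex.exp_nat_mul, show ((i + 1 : ℕ) : ℂ) * (2 * Real.pi * t * Complex.I)
    = ((2 * Real.pi * (i + 1) * t : ℝ) : ℂ) * Complex.I by push_cast; ring,
    show (i : ℂ) + 1 = (((i : ℝ) + 1 : ℝ) : ℂ) by push_cast; rfl, Complex.div_ofReal_re,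
    Complex.exp_ofReal_mul_I_re]

section Sums

variable {E : Type*} [AddCommMonoid E]

theorem sum_Icc_neg_eq (f : ℤ → E) (M : ℕ) :
    ∑ m ∈ Icc (-(M : ℤ)) M, f m
      = f 0 + ∑ i ∈ range M, (f (i + 1) + f (-(i + 1))) := by
  induction M with
  | zero => simp
  | succ M ih =>
    have h : Icc (-((M + 1 : ℕ) : ℤ)) ((M + 1 : ℕ) : ℤ)
        = insert ((M : ℤ) + 1) (insert (-((M : ℤ) + 1)) (Icc (-(M : ℤ)) M)) := by
      ext x; simp only [mem_Icc, mem_insert]; omega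
    rw [h, sum_insert, sum_insert, ih, sum_range_succ]
    · abel
    · simp only [mem_Icc]; omega
    · simp only [mem_Icc, mem_insert]; omega

theorem sum_puncturedIndices_eq (f : ℤ → E) (M : ℕ) :
    ∑ m ∈ puncturedIndices M, f m = ∑ i ∈ range M, (f (i + 1) + f (-(i + 1))) := by
  have key := sum_Icc_neg_eq (fun m => if m = 0 then 0 else f m) M
  rw [← add_sum_erase _ _ (show (0 : ℤ) ∈ Icc (-(M : ℤ)) M by simp)] at key
  simp only [↓reduceIte, zero_add] at key
  rw [sum_congr rfl fun m hm => (if_neg (ne_of_mem_erase hm)).symm, key]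
  refine sum_congr rfl fun i _ => ?_
  rw [if_neg (by omega), if_neg (by omega)]

theorem sum_puncturedIndices_of_periodic (f : ℤ → E) (M : ℕ)
    (hf : Function.Periodic f (2 * M + 1)) :
    ∑ m ∈ puncturedIndices M, f m = ∑ i ∈ range (2 * M), f (i + 1) := by
  rw [sum_puncturedIndices_eq, sum_add_distrib, two_mul, sum_range_add]
  congr 1
  rw [← sum_range_reflect]
  refine sum_congr rfl fun i hi => ?_
  have hi' := mem_range.1 hi
  rw [← hf]
  congr 1
  push_cast [Nat.sub_sub, Nat.cast_sub (show 1 + i ≤ M by omega)]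
  ring

end Sums

theorem periodic_cos_mul_div (M : ℕ) (k : ℤ) :
    Function.Periodic (fun m : ℤ => Real.cos (2 * Real.pi * k * (m / (2 * M + 1)))) (2 * M + 1) := by
  intro m
  have hN : (2 * (M : ℝ) + 1) ≠ 0 := by positivity
  show Real.cos _ = Real.cos _
  rw [show 2 * Real.pi * k * (((m + (2 * M + 1) : ℤ) : ℝ) / (2 * M + 1))
    = 2 * Real.pi * k * (m / (2 * M + 1)) + k * (2 * Real.pi) by push_cast; field_simp]
  exact Real.cos_add_int_mul_two_pi _ k

theorem sum_cos_eq (M : ℕ) (k : ℤ) :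
    ∑ m ∈ puncturedIndices M, Real.cos (2 * Real.pi * k * (m / (2 * M + 1))) =
      (if (2 * M + 1 : ℤ) ∣ k then (2 * M + 1 : ℝ) else 0) - 1 := by
  have hN : (2 * (M : ℝ) + 1) ≠ 0 := by positivity
  rw [sum_puncturedIndices_of_periodic _ M (periodic_cos_mul_div M k), eq_sub_iff_add_eq]
  have h0 := sum_range_succ' (fun i : ℕ => Real.cos (2 * Real.pi * k * (i / (2 * M + 1)))) (2 * M)
  simp only [Nat.cast_zero, zero_div, mul_zero, Real.cos_zero] at h0
  push_cast at h0 ⊢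
  rw [← h0]
  set z := Complex.exp (2 * Real.pi * Complex.I * (k / ((2 * M + 1 : ℕ) : ℂ))) with hz
  have hterm (i : ℕ) : Real.cos (2 * Real.pi * k * (i / (2 * M + 1))) = (z ^ i).re := by
    rw [hz, ← Complex.exp_nat_mul, ← Complex.exp_ofReal_mul_I_re]
    congr 2; push_cast; ring
  simp only [hterm, ← Complex.re_sum]
  have hzN : z ^ (2 * M + 1) = 1 := by
    rw [hz, ← Complex.exp_nat_mul, Complex.exp_eq_one_iff]
    refine ⟨k, ?_⟩
    have : (2 * (M : ℂ) + 1) ≠ 0 := by exact_mod_cast hN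
    push_cast; field_simp
  have hz1 : z = 1 ↔ (2 * M + 1 : ℤ) ∣ k := by
    rw [hz, Complex.exp_eq_one_iff]
    have hc : (2 * (M : ℂ) + 1) ≠ 0 := by exact_mod_cast hN
    have hpi : (2 * (Real.pi : ℂ) * Complex.I) ≠ 0 := by simp [Real.pi_ne_zero]
    constructor
    · rintro ⟨n, hn⟩
      rw [mul_comm (n : ℂ), mul_right_inj' hpi] at hn
      push_cast at hn
      rw [div_eq_iff hc] at hn
      exact ⟨n, by rw [mul_comm]; exact_mod_cast hn⟩
    · rintro ⟨n, rfl⟩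
      refine ⟨n, ?_⟩
      push_cast; field_simp
  by_cases h : z = 1
  · rw [if_pos (hz1.1 h), h]; simp
  · rw [if_neg (hz1.not.1 h), geom_sum_eq h, hzN]; simp

theorem logKernel_periodic : Function.Periodic logKernel 1 := by
  intro t
  rw [logKernel, logKernel, mul_add, mul_one, Real.sin_add_pi, mul_neg, Real.log_neg_eq_log]

theorem logKernel_eq_neg_log_norm (t : ℝ) :
    logKernel t = -Real.log ‖1 - Complex.exp (2 * Real.pi * t * Complex.I)‖ := by
  rw [norm_one_sub_exp, Real.log_abs, logKernel]

theorem sum_logKernel (M : ℕ) :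
    ∑ m ∈ puncturedIndices M, logKernel (m / (2 * M + 1)) = -Real.log (2 * M + 1) := by
  have hN : (2 * (M : ℝ) + 1) ≠ 0 := by positivity
  rw [sum_puncturedIndices_of_periodic (fun m : ℤ => logKernel (m / (2 * M + 1))) M]
  · have hprim : IsPrimitiveRoot (Complex.exp (2 * Real.pi * Complex.I / ((2 * M + 1 : ℕ) : ℂ)))
        (2 * M + 1) := Complex.isPrimitiveRoot_exp _ (by omega)
    have hprod := congrArg (fun z : ℂ => Real.log ‖z‖) hprim.prod_one_sub_pow_eq_order
    simp only [norm_prod] at hprod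
    rw [Real.log_prod] at hprod
    · rw [show (((2 * M : ℕ) : ℂ) + 1) = ((2 * M + 1 : ℝ) : ℂ) by push_cast; rfl,
        Complex.norm_real, Real.norm_of_nonneg (by positivity)] at hprod
      rw [← hprod, ← sum_neg_distrib]
      refine sum_congr rfl fun i _ => ?_
      rw [logKernel_eq_neg_log_norm, ← Complex.exp_nat_mul]
      congr 5
      push_cast; ring
    · intro i hi h
      rw [norm_eq_zero, sub_eq_zero] at h
      have := hprim.pow_ne_one_of_pos_of_lt (l := i + 1) (by omega)
        (by have := mem_range.1 hi; omega)
      exact this h.symm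
  · intro m
    show logKernel _ = logKernel _
    rw [show ((m + (2 * M + 1) : ℤ) : ℝ) / (2 * M + 1) = m / (2 * M + 1) + 1 by
      push_cast; field_simp]
    exact logKernel_periodic _

theorem sin_pi_mul_div_ne_zero {M : ℕ} {m : ℤ} (hm : m ∈ puncturedIndices M) :
    Real.sin (Real.pi * (m / (2 * M + 1))) ≠ 0 := by
  have hN : (2 * (M : ℝ) + 1) ≠ 0 := by positivity
  rw [Ne, Real.sin_eq_zero_iff]
  rintro ⟨j, hj⟩
  have h : (m : ℝ) = j * (2 * M + 1) := by
    have := Real.pi_ne_zero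
    field_simp at hj
    linarith
  have h' : m = j * (2 * M + 1) := by exact_mod_cast h
  simp only [puncturedIndices, mem_erase, mem_Icc] at hm
  have : |m| < 2 * M + 1 := abs_lt.2 (by omega)
  exact hm.1 (Int.eq_zero_of_abs_lt_dvd ⟨j, by rw [h', mul_comm]⟩ this)

/-- The discrete cosine transform of the logarithmic kernel on the punctured grid. -/
noncomputable def logKernelSum (M : ℕ) (n : ℕ) : ℝ :=
  ∑ m ∈ puncturedIndices M,
    logKernel (m / (2 * M + 1)) * Real.cos (2 * Real.pi * n * (m / (2 * M + 1)))

theorem logKernelSum_zero (M : ℕ) : logKernelSum M 0 = -Real.log (2 * M + 1) := by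
  rw [← sum_logKernel, logKernelSum]
  exact sum_congr rfl fun m _ => by simp

theorem sum_cos_mul_cos_sub_one (M n k : ℕ) :
    ∑ m ∈ puncturedIndices M, Real.cos (2 * Real.pi * k * (m / (2 * M + 1)))
        * (Real.cos (2 * Real.pi * n * (m / (2 * M + 1))) - 1) =
      (2 * M + 1) * ((if (2 * M + 1 : ℤ) ∣ (k : ℤ) + n then 1 / 2 else 0)
        + (if (2 * M + 1 : ℤ) ∣ (k : ℤ) - n then 1 / 2 else 0)
        - (if (2 * M + 1 : ℤ) ∣ (k : ℤ) then 1 else 0)) := by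
  have h1 := sum_cos_eq M ((k : ℤ) + n)
  have h2 := sum_cos_eq M ((k : ℤ) - n)
  have h3 := sum_cos_eq M (k : ℤ)
  have h (m : ℤ) : Real.cos (2 * Real.pi * k * (m / (2 * M + 1)))
      * (Real.cos (2 * Real.pi * n * (m / (2 * M + 1))) - 1) =
      1 / 2 * Real.cos (2 * Real.pi * ((k : ℤ) + n : ℤ) * (m / (2 * M + 1)))
      + 1 / 2 * Real.cos (2 * Real.pi * ((k : ℤ) - n : ℤ) * (m / (2 * M + 1)))
      - Real.cos (2 * Real.pi * (k : ℤ) * (m / (2 * M + 1))) := by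
    push_cast
    rw [show 2 * Real.pi * ((k : ℝ) + n) * (m / (2 * M + 1)) =
      2 * Real.pi * k * (m / (2 * M + 1)) + 2 * Real.pi * n * (m / (2 * M + 1)) by ring,
      show 2 * Real.pi * ((k : ℝ) - n) * (m / (2 * M + 1)) =
      2 * Real.pi * k * (m / (2 * M + 1)) - 2 * Real.pi * n * (m / (2 * M + 1)) by ring,
      Real.cos_add, Real.cos_sub]
    ring
  simp only [h, sum_sub_distrib, sum_add_distrib, ← mul_sum, h1, h2, h3]
  split_ifs <;> ring

theorem tendsto_logKernelSum_sub (M n : ℕ) :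
    Tendsto (fun p => ∑ i ∈ range p, 1 / ((i : ℝ) + 1) * ((2 * M + 1) *
        ((if (2 * M + 1 : ℤ) ∣ ((i + 1 : ℕ) : ℤ) + n then 1 / 2 else 0)
        + (if (2 * M + 1 : ℤ) ∣ ((i + 1 : ℕ) : ℤ) - n then 1 / 2 else 0)
        - (if (2 * M + 1 : ℤ) ∣ ((i + 1 : ℕ) : ℤ) then 1 else 0)))) atTop
      (𝓝 (logKernelSum M n - logKernelSum M 0)) := by
  have h := tendsto_finsetSum (puncturedIndices M) fun m hm =>
    (tendsto_sum_cos_div_logKernel (sin_pi_mul_div_ne_zero hm)).mul_const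
      (Real.cos (2 * Real.pi * n * (m / (2 * M + 1))) - 1)
  have hl : ∑ m ∈ puncturedIndices M, logKernel (m / (2 * M + 1)) *
      (Real.cos (2 * Real.pi * n * (m / (2 * M + 1))) - 1)
      = logKernelSum M n - logKernelSum M 0 := by
    simp [logKernelSum, mul_sub, sum_sub_distrib]
  rw [hl] at h
  refine h.congr fun p => ?_
  simp only [← sum_cos_mul_cos_sub_one, sum_mul]
  rw [sum_comm]
  refine sum_congr rfl fun i _ => ?_
  rw [mul_sum]
  refine sum_congr rfl fun m _ => ?_
  push_cast
  ring

/-- One period of an arithmetic-progression sum. -/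
theorem sum_range_ite_dvd (N Q r : ℕ) (c : ℤ) (f : ℕ → ℝ) (v : ℝ) (hr : r < N)
    (hc : (N : ℤ) ∣ ((r + 1 : ℕ) : ℤ) + c) :
    ∑ i ∈ range N, f (Q * N + i) * (if (N : ℤ) ∣ ((Q * N + i + 1 : ℕ) : ℤ) + c then v else 0)
      = f (Q * N + r) * v := by
  rw [sum_eq_single r]
  · rw [if_pos]
    have : ((Q * N + r + 1 : ℕ) : ℤ) + c = Q * N + (((r + 1 : ℕ) : ℤ) + c) := by push_cast; ring
    rw [this]
    exact (dvd_mul_left _ _).add hc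
  · intro i hi hir
    rw [if_neg, mul_zero]
    intro hd
    have h1 : (N : ℤ) ∣ (i : ℤ) - r := by
      have h2 := (hd.sub hc).sub (dvd_mul_left (N : ℤ) Q)
      have h3 : ((Q * N + i + 1 : ℕ) : ℤ) + c - (((r + 1 : ℕ) : ℤ) + c) - Q * N = i - r := by
        push_cast; ring
      rwa [h3] at h2
    have h4 := Int.eq_zero_of_abs_lt_dvd h1 (by
      have := mem_range.1 hi
      rw [abs_lt]; omega)
    omega
  · intro h
    exact absurd (mem_range.2 hr) h

theorem one_div_symm_sub {N p y : ℝ} (hN : N ≠ 0) (hp : p ≠ 0) (h1 : p * N - y ≠ 0)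
    (h2 : p * N + y ≠ 0) :
    N / (2 * (p * N - y)) + N / (2 * (p * N + y)) - 1 / p
      = (y / N) ^ 2 / (p * (p ^ 2 - (y / N) ^ 2)) := by
  have h : p ^ 2 - (y / N) ^ 2 = (p * N - y) * (p * N + y) / N ^ 2 := by
    field_simp; ring
  rw [h, div_add_div _ _ (by positivity) (by positivity), div_sub_div _ _ (by positivity) hp,
    div_eq_div_iff (by positivity) (by positivity)]
  field_simp
  ring

theorem sum_blocks {M n : ℕ} (hn : 1 ≤ n) (hnM : n ≤ M) (Q : ℕ) :
    ∑ i ∈ range (Q * (2 * M + 1)), 1 / ((i : ℝ) + 1) * ((2 * M + 1) *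
        ((if (2 * M + 1 : ℤ) ∣ ((i + 1 : ℕ) : ℤ) + n then 1 / 2 else 0)
        + (if (2 * M + 1 : ℤ) ∣ ((i + 1 : ℕ) : ℤ) - n then 1 / 2 else 0)
        - (if (2 * M + 1 : ℤ) ∣ ((i + 1 : ℕ) : ℤ) then 1 else 0))) =
      (2 * M + 1) / (2 * n) - (2 * M + 1) / (2 * (Q * (2 * M + 1) + n)) +
      ∑ q ∈ range Q, (n / (2 * M + 1 : ℝ)) ^ 2 /
        (((q : ℝ) + 1) * (((q : ℝ) + 1) ^ 2 - (n / (2 * M + 1 : ℝ)) ^ 2)) := by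
  have hn' : (0 : ℝ) < n := by exact_mod_cast hn
  have hnM' : (n : ℝ) ≤ M := by exact_mod_cast hnM
  induction Q with
  | zero => simp
  | succ Q ih =>
    rw [add_mul, one_mul, sum_range_add, ih, sum_range_succ _ Q]
    have hcast : (2 * M + 1 : ℤ) = ((2 * M + 1 : ℕ) : ℤ) := by push_cast; rfl
    have e1 := sum_range_ite_dvd (2 * M + 1) Q (2 * M - n) n
      (fun i => 1 / ((i : ℝ) + 1)) (1 / 2) (by omega) ⟨1, by omega⟩
    have e2 := sum_range_ite_dvd (2 * M + 1) Q (n - 1) (-n)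
      (fun i => 1 / ((i : ℝ) + 1)) (1 / 2) (by omega) ⟨0, by omega⟩
    have e3 := sum_range_ite_dvd (2 * M + 1) Q (2 * M) 0
      (fun i => 1 / ((i : ℝ) + 1)) 1 (by omega) ⟨1, by omega⟩
    simp only [← hcast, add_zero, ← sub_eq_add_neg] at e1 e2 e3
    have hsplit : ∑ i ∈ range (2 * M + 1), 1 / (((Q * (2 * M + 1) + i : ℕ) : ℝ) + 1) *
        ((2 * M + 1) *
        ((if (2 * M + 1 : ℤ) ∣ ((Q * (2 * M + 1) + i + 1 : ℕ) : ℤ) + n then 1 / 2 else 0)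
        + (if (2 * M + 1 : ℤ) ∣ ((Q * (2 * M + 1) + i + 1 : ℕ) : ℤ) - n then 1 / 2 else 0)
        - (if (2 * M + 1 : ℤ) ∣ ((Q * (2 * M + 1) + i + 1 : ℕ) : ℤ) then 1 else 0))) =
        (2 * M + 1) * (1 / (((Q * (2 * M + 1) + (2 * M - n) : ℕ) : ℝ) + 1) * (1 / 2)
          + 1 / (((Q * (2 * M + 1) + (n - 1) : ℕ) : ℝ) + 1) * (1 / 2)
          - 1 / (((Q * (2 * M + 1) + 2 * M : ℕ) : ℝ) + 1) * 1) := by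
      rw [← e1, ← e2, ← e3, ← sum_add_distrib, ← sum_sub_distrib, mul_sum]
      exact sum_congr rfl fun i _ => by ring
    rw [hsplit]
    push_cast [Nat.cast_sub (show n ≤ 2 * M by omega), Nat.cast_sub hn]
    have hN : (0 : ℝ) < 2 * M + 1 := by positivity
    have d1 : (Q : ℝ) * (2 * M + 1) + (2 * M - n) + 1 ≠ 0 := by nlinarith [show (0:ℝ) ≤ Q by positivity]
    have d1' : ((Q : ℝ) + 1) * (2 * M + 1) - n ≠ 0 := by
      intro h; apply d1; linarith
    have d2 : ((Q : ℝ) + 1) * (2 * M + 1) + n ≠ 0 := by positivity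
    have d4 : (Q : ℝ) + 1 ≠ 0 := by positivity
    have hx := one_div_symm_sub (p := (Q : ℝ) + 1) (y := n) hN.ne' d4 d1' d2
    rw [← hx,
      show (Q : ℝ) * (2 * M + 1) + (2 * M - n) + 1 = (Q + 1) * (2 * M + 1) - n by ring,
      show (Q : ℝ) * (2 * M + 1) + (n - 1) + 1 = Q * (2 * M + 1) + n by ring,
      show (Q : ℝ) * (2 * M + 1) + 2 * M + 1 = (Q + 1) * (2 * M + 1) by ring]
    generalize ((Q : ℝ) + 1) * (2 * M + 1) - n = A
    generalize ((Q : ℝ) + 1) * (2 * M + 1) + n = B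
    generalize (Q : ℝ) * (2 * M + 1) + n = D
    have hP : (2 * (M : ℝ) + 1) * (1 / ((Q + 1) * (2 * M + 1))) = 1 / (Q + 1) := by
      field_simp
    rw [mul_sub, mul_one (1 / _), hP]
    ring

theorem hasSum_logKernelSum {M n : ℕ} (hn : 1 ≤ n) (hnM : n ≤ M) :
    HasSum (fun q : ℕ => (n / (2 * M + 1 : ℝ)) ^ 2 /
        (((q : ℝ) + 1) * (((q : ℝ) + 1) ^ 2 - (n / (2 * M + 1 : ℝ)) ^ 2)))
      (logKernelSum M n + Real.log (2 * M + 1) - (2 * M + 1) / (2 * n)) := by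
  have hn' : (0 : ℝ) < n := by exact_mod_cast hn
  have hnM' : (n : ℝ) ≤ M := by exact_mod_cast hnM
  rw [hasSum_iff_tendsto_nat_of_nonneg]
  · have h1 : Tendsto (fun Q : ℕ => Q * (2 * M + 1)) atTop atTop :=
      tendsto_id.atTop_mul_const' (by omega)
    have h2 := (tendsto_logKernelSum_sub M n).comp h1
    have h3 : Tendsto (fun Q : ℕ => (2 * M + 1 : ℝ) / (2 * (Q * (2 * M + 1) + n))) atTop (𝓝 0) := by
      refine Tendsto.const_div_atTop ?_ _
      refine Tendsto.const_mul_atTop two_pos (tendsto_atTop_add_const_right _ _ ?_)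
      exact tendsto_natCast_atTop_atTop.atTop_mul_const (by positivity)
    have h4 := (h2.sub_const ((2 * M + 1 : ℝ) / (2 * n))).add h3
    rw [logKernelSum_zero, add_zero, sub_neg_eq_add] at h4
    refine h4.congr fun Q => ?_
    simp only [Function.comp_apply]
    rw [sum_blocks hn hnM Q]
    ring
  · intro q
    have : n / (2 * (M : ℝ) + 1) ≤ 1 := by rw [div_le_one (by positivity)]; linarith
    have h5 : (n / (2 * M + 1 : ℝ)) ^ 2 ≤ 1 := by apply pow_le_one₀ (by positivity) this
    have h6 : (1 : ℝ) ≤ ((q : ℝ) + 1) ^ 2 := one_le_pow₀ (by linarith [q.cast_nonneg (α := ℝ)])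
    have h7 : 0 ≤ ((q : ℝ) + 1) ^ 2 - (n / (2 * M + 1 : ℝ)) ^ 2 := by linarith
    positivity

theorem intervalIntegrable_logKernel (a b : ℝ) :
    IntervalIntegrable logKernel MeasureTheory.volume a b := by
  have h : AnalyticOnNhd ℝ (fun t : ℝ => 2 * Real.sin (Real.pi * t)) (Set.uIcc a b) := by
    intro t _
    fun_prop
  exact h.meromorphicOn.intervalIntegrable_log.neg

theorem logKernel_one_sub (t : ℝ) : logKernel (1 - t) = logKernel t := by
  rw [logKernel, logKernel, mul_sub, mul_one, Real.sin_pi_sub]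

theorem logKernel_neg (t : ℝ) : logKernel (-t) = logKernel t := by
  rw [← logKernel_one_sub, sub_neg_eq_add, add_comm, logKernel_periodic]

theorem integral_logKernel : ∫ t in (0 : ℝ)..1, logKernel t = 0 := by
  have h1 : ∫ t in (0 : ℝ)..1, Real.log (Real.sin (Real.pi * t)) = -Real.log 2 := by
    rw [intervalIntegral.integral_comp_mul_left (fun t => Real.log (Real.sin t)) Real.pi_ne_zero,
      mul_zero, mul_one, integral_log_sin_zero_pi, smul_eq_mul]
    field_simp
  have h2 : IntervalIntegrable (fun t => Real.log (Real.sin (Real.pi * t))) MeasureTheory.volume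
      0 1 := by
    have h : AnalyticOnNhd ℝ (fun t : ℝ => Real.sin (Real.pi * t)) (Set.uIcc 0 1) := by
      intro t _
      fun_prop
    exact h.meromorphicOn.intervalIntegrable_log
  have h3 : ∫ t in (0 : ℝ)..1, logKernel t
      = ∫ t in (0 : ℝ)..1, (-Real.log 2 - Real.log (Real.sin (Real.pi * t))) := by
    refine intervalIntegral.integral_congr_Ioo_of_le zero_le_one fun t ht => ?_
    have : 0 < Real.sin (Real.pi * t) := Real.sin_pos_of_pos_of_lt_pi
      (mul_pos Real.pi_pos ht.1) (by nlinarith [Real.pi_pos, ht.2])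
    show logKernel t = _
    rw [logKernel, Real.log_mul two_ne_zero this.ne']
    ring
  rw [h3, intervalIntegral.integral_sub (by simp) h2, h1]
  simp

/-- The quotient `sin 2nθ / sin θ` as a trigonometric polynomial. -/
noncomputable def sinQuotient (n : ℕ) (θ : ℝ) : ℝ := ∑ k ∈ range n, 2 * Real.cos ((2 * k + 1) * θ)

theorem sin_mul_sinQuotient (n : ℕ) (θ : ℝ) :
    Real.sin θ * sinQuotient n θ = Real.sin (2 * n * θ) := by
  induction n with
  | zero => simp [sinQuotient]
  | succ n ih =>
    rw [sinQuotient, sum_range_succ, mul_add, ← sinQuotient, ih]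
    push_cast
    rw [show 2 * ((n : ℝ) + 1) * θ = (2 * n + 1) * θ + θ by ring,
      show 2 * (n : ℝ) * θ = (2 * n + 1) * θ - θ by ring, Real.sin_add, Real.sin_sub]
    ring

theorem continuous_sinQuotient (n : ℕ) : Continuous (sinQuotient n) := by
  unfold sinQuotient; fun_prop

theorem integral_cos_two_pi_mul (k : ℕ) :
    ∫ t in (0 : ℝ)..1, Real.cos (2 * Real.pi * k * t) = if k = 0 then 1 else 0 := by
  split_ifs with hk
  · simp [hk]
  · have hk' : 2 * Real.pi * k ≠ 0 := by
      have : (k : ℝ) ≠ 0 := by exact_mod_cast hk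
      have := Real.pi_ne_zero
      positivity
    rw [intervalIntegral.integral_comp_mul_left _ hk', integral_cos, mul_zero, mul_one,
      show 2 * Real.pi * k = ((2 * k : ℕ) : ℝ) * Real.pi by push_cast; ring, Real.sin_nat_mul_pi]
    simp

theorem integral_cos_mul_sinQuotient {n : ℕ} (hn : 1 ≤ n) :
    ∫ t in (0 : ℝ)..1, Real.cos (Real.pi * t) * sinQuotient n (Real.pi * t) = 1 := by
  have h (t : ℝ) : Real.cos (Real.pi * t) * sinQuotient n (Real.pi * t)
      = ∑ k ∈ range n, (Real.cos (2 * Real.pi * (k + 1 : ℕ) * t)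
        + Real.cos (2 * Real.pi * k * t)) := by
    rw [sinQuotient, mul_sum]
    refine sum_congr rfl fun k _ => ?_
    push_cast
    rw [show 2 * Real.pi * ((k : ℝ) + 1) * t = (2 * k + 1) * (Real.pi * t) + Real.pi * t by ring,
      show 2 * Real.pi * (k : ℝ) * t = (2 * k + 1) * (Real.pi * t) - Real.pi * t by ring,
      Real.cos_add, Real.cos_sub]
    ring
  have hc (k : ℕ) : IntervalIntegrable (fun t : ℝ => Real.cos (2 * Real.pi * k * t))
      MeasureTheory.volume 0 1 := Continuous.intervalIntegrable (by fun_prop) _ _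
  simp only [h]
  rw [intervalIntegral.integral_finsetSum fun k _ => (hc (k + 1)).add (hc k)]
  simp only [intervalIntegral.integral_add (hc _) (hc _), integral_cos_two_pi_mul]
  obtain ⟨m, rfl⟩ := Nat.exists_eq_add_of_le' hn
  simp

theorem integral_logKernel_mul_cos {n : ℕ} (hn : 1 ≤ n) :
    ∫ t in (0 : ℝ)..1, logKernel t * Real.cos (2 * Real.pi * n * t) = 1 / (2 * n) := by
  have hn' : (n : ℝ) ≠ 0 := by positivity
  have hpi := Real.pi_ne_zero
  set F : ℝ → ℝ := fun t => -(1 / (4 * Real.pi * n)) *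
    ((2 * Real.sin (Real.pi * t)) * Real.log (2 * Real.sin (Real.pi * t)))
      * sinQuotient n (Real.pi * t) with hF
  have hF' (t : ℝ) : F t = logKernel t * Real.sin (2 * Real.pi * n * t) / (2 * Real.pi * n) := by
    rw [hF, logKernel, show 2 * Real.pi * n * t = 2 * n * (Real.pi * t) by ring,
      ← sin_mul_sinQuotient]
    field_simp
    ring
  have hFc : Continuous F := by
    refine (continuous_const.mul (Real.continuous_mul_log.comp ?_)).mul
      ((continuous_sinQuotient n).comp (by fun_prop))
    fun_prop
  have hd : ∀ t ∈ Set.Ioo (0 : ℝ) 1, HasDerivAt F (logKernel t * Real.cos (2 * Real.pi * n * t)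
      - Real.cos (Real.pi * t) * sinQuotient n (Real.pi * t) * (1 / (2 * n))) t := by
    intro t ht
    have hs : 0 < Real.sin (Real.pi * t) := Real.sin_pos_of_pos_of_lt_pi
      (mul_pos Real.pi_pos ht.1) (by nlinarith [Real.pi_pos, ht.2])
    have h1 : HasDerivAt (fun t => Real.pi * t) Real.pi t := by
      simpa using (hasDerivAt_id t).const_mul Real.pi
    have h2 : HasDerivAt logKernel
        (-(2 * (Real.cos (Real.pi * t) * Real.pi) / (2 * Real.sin (Real.pi * t)))) t :=
      ((h1.sin.const_mul 2).log (by positivity)).neg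
    have h3 : HasDerivAt (fun t => 2 * Real.pi * n * t) (2 * Real.pi * n) t := by
      simpa using (hasDerivAt_id t).const_mul (2 * Real.pi * n)
    have h4 := (h2.mul h3.sin).div_const (2 * Real.pi * n)
    have h5 : F = fun t => logKernel t * Real.sin (2 * Real.pi * n * t) / (2 * Real.pi * n) :=
      funext hF'
    rw [h5]
    refine HasDerivAt.congr_deriv (f' := _) h4 ?_
    have h6 := sin_mul_sinQuotient n (Real.pi * t)
    rw [show 2 * (n : ℝ) * (Real.pi * t) = 2 * Real.pi * n * t by ring] at h6
    rw [← h6]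
    field_simp
    ring
  have hi1 : IntervalIntegrable (fun t => logKernel t * Real.cos (2 * Real.pi * n * t))
      MeasureTheory.volume 0 1 :=
    (intervalIntegrable_logKernel 0 1).mul_continuousOn (by fun_prop)
  have hi2 : IntervalIntegrable (fun t => Real.cos (Real.pi * t) * sinQuotient n (Real.pi * t)
      * (1 / (2 * n))) MeasureTheory.volume 0 1 := by
    refine Continuous.intervalIntegrable ?_ _ _
    have := continuous_sinQuotient n
    fun_prop
  have h := intervalIntegral.integral_eq_sub_of_hasDerivAt_of_le zero_le_one hFc.continuousOn hd
    (hi1.sub hi2)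
  rw [intervalIntegral.integral_sub hi1 hi2, intervalIntegral.integral_mul_const,
    integral_cos_mul_sinQuotient hn, hF] at h
  simp only [mul_zero, mul_one, Real.sin_zero, Real.sin_pi, zero_mul, sub_zero, one_mul] at h
  linarith

theorem integral_logKernel_mul_sin (n : ℤ) :
    ∫ t in (0 : ℝ)..1, logKernel t * Real.sin (2 * Real.pi * n * t) = 0 := by
  have h := intervalIntegral.integral_comp_sub_left
    (fun t => logKernel t * Real.sin (2 * Real.pi * n * t)) (a := 0) (b := 1) 1
  have h2 (t : ℝ) : logKernel (1 - t) * Real.sin (2 * Real.pi * n * (1 - t))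
      = -(logKernel t * Real.sin (2 * Real.pi * n * t)) := by
    rw [logKernel_one_sub, show 2 * Real.pi * n * (1 - t) = n * (2 * Real.pi) - 2 * Real.pi * n * t
      by ring, Real.sin_int_mul_two_pi_sub]
    ring
  simp only [h2, intervalIntegral.integral_neg, sub_self, sub_zero] at h
  linarith

/-- The Taylor polynomial of the cosine with `n` terms. -/
noncomputable def cosTaylor (n : ℕ) (y : ℝ) : ℝ :=
  ∑ k ∈ range n, (-1) ^ k * y ^ (2 * k) / (2 * k).factorial

theorem abs_cos_sub_cosTaylor_le (n : ℕ) (y : ℝ) :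
    |Real.cos y - cosTaylor n y| ≤ |y| ^ (2 * n) * Real.exp |y| := by
  have hre : (∑ m ∈ range (2 * n), (y * Complex.I) ^ m / (m.factorial : ℂ)).re = cosTaylor n y := by
    induction n with
    | zero => simp [cosTaylor]
    | succ n ih =>
      have h2 : ((y : ℂ) * Complex.I) ^ (2 * n) = (((-1) ^ n * y ^ (2 * n) : ℝ) : ℂ) := by
        rw [mul_pow, pow_mul Complex.I, Complex.I_sq]; push_cast; ring
      rw [show 2 * (n + 1) = 2 * n + 1 + 1 by ring, sum_range_succ, sum_range_succ, Complex.add_re,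
        Complex.add_re, ih, cosTaylor, cosTaylor, sum_range_succ, pow_succ, h2,
        ← Complex.ofReal_natCast, ← Complex.ofReal_natCast, Complex.div_ofReal_re,
        Complex.div_ofReal_re, Complex.ofReal_re, ← mul_assoc, ← Complex.ofReal_mul,
        Complex.re_ofReal_mul, Complex.I_re]
      simp
  have h := Complex.norm_exp_sub_sum_le_norm_mul_exp (y * Complex.I) (2 * n)
  rw [norm_mul, Complex.norm_I, mul_one, Complex.norm_real, Real.norm_eq_abs] at h
  refine le_trans ?_ ((Complex.abs_re_le_norm _).trans h)
  rw [Complex.sub_re, hre, Complex.exp_ofReal_mul_I_re]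

theorem summable_oddZeta (k : ℕ) :
    Summable fun q : ℕ => 1 / ((q : ℝ) + 1) ^ (2 * (k + 1) + 1) := by
  have h := (summable_nat_add_iff 1).2
    (Real.summable_one_div_nat_pow.2 (show 1 < 2 * (k + 1) + 1 by omega))
  simpa using h

theorem geometric_remainder {p x : ℝ} (hp : p ≠ 0) (h : p ^ 2 - x ^ 2 ≠ 0) (K : ℕ) :
    x ^ 2 / (p * (p ^ 2 - x ^ 2)) - ∑ k ∈ range K, x ^ (2 * (k + 1)) * (1 / p ^ (2 * (k + 1) + 1))
      = x ^ (2 * K + 2) / (p ^ (2 * K + 1) * (p ^ 2 - x ^ 2)) := by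
  induction K with
  | zero => simp
  | succ K ih =>
    rw [sum_range_succ, ← sub_sub, ih, mul_one_div, div_sub_div _ _ (by positivity) (by positivity),
      div_eq_div_iff (by positivity) (by positivity)]
    ring

theorem abs_sub_oddZeta_le {x S : ℝ} (hx0 : 0 ≤ x) (hx : x ≤ 1 / 2) (K : ℕ)
    (hS : HasSum (fun q : ℕ => x ^ 2 / (((q : ℝ) + 1) * (((q : ℝ) + 1) ^ 2 - x ^ 2))) S) :
    |S - ∑ k ∈ range K, x ^ (2 * (k + 1)) * oddZeta (k + 1)|
      ≤ 4 / 3 * oddZeta 1 * x ^ (2 * K + 2) := by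
  have hp (q : ℕ) : (1 : ℝ) ≤ (q : ℝ) + 1 := by linarith [q.cast_nonneg (α := ℝ)]
  have hden (q : ℕ) : 3 / 4 * ((q : ℝ) + 1) ^ 2 ≤ ((q : ℝ) + 1) ^ 2 - x ^ 2 := by
    nlinarith [hp q, one_le_pow₀ (n := 2) (hp q)]
  have hden' (q : ℕ) : 0 < ((q : ℝ) + 1) ^ 2 - x ^ 2 :=
    lt_of_lt_of_le (by positivity) (hden q)
  have hsum := hS.sub (hasSum_sum (s := range K) fun k _ =>
    ((summable_oddZeta k).hasSum.mul_left (x ^ (2 * (k + 1)))))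
  have hrem (q : ℕ) := geometric_remainder (x := x) (p := (q : ℝ) + 1) (by positivity)
    (hden' q).ne' K
  simp only [hrem] at hsum
  have hnn := hsum.nonneg fun q => by have := hden' q; positivity
  have hle := hasSum_le (fun q => ?_) hsum
    ((summable_oddZeta 0).hasSum.mul_left (4 / 3 * x ^ (2 * K + 2)))
  · rw [abs_le]
    simp only [oddZeta] at *
    constructor
    · have h1 : 0 ≤ ∑' q : ℕ, 1 / ((q : ℝ) + 1) ^ (2 * 1 + 1) :=
        tsum_nonneg fun q => by positivity
      have : 0 ≤ 4 / 3 * (∑' q : ℕ, 1 / ((q : ℝ) + 1) ^ (2 * 1 + 1)) * x ^ (2 * K + 2) := by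
        positivity
      linarith
    · refine hle.trans_eq ?_
      ring
  · have h1 : ((q : ℝ) + 1) ≤ ((q : ℝ) + 1) ^ (2 * K + 1) := le_self_pow₀ (hp q) (by omega)
    have h2 : 3 / 4 * ((q : ℝ) + 1) ^ 3
        ≤ ((q : ℝ) + 1) ^ (2 * K + 1) * (((q : ℝ) + 1) ^ 2 - x ^ 2) := by
      calc 3 / 4 * ((q : ℝ) + 1) ^ 3 = ((q : ℝ) + 1) * (3 / 4 * ((q : ℝ) + 1) ^ 2) := by ring
        _ ≤ _ := mul_le_mul h1 (hden q) (by positivity) (by positivity)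
    calc x ^ (2 * K + 2) / (((q : ℝ) + 1) ^ (2 * K + 1) * (((q : ℝ) + 1) ^ 2 - x ^ 2))
        ≤ x ^ (2 * K + 2) / (3 / 4 * ((q : ℝ) + 1) ^ 3) := by gcongr
      _ = 4 / 3 * x ^ (2 * K + 2) * (1 / ((q : ℝ) + 1) ^ (2 * (0 + 1) + 1)) := by
        field_simp

theorem sum_weights_mul_cosTaylor {K : ℕ} {w : Fin (K + 1) → ℝ} (hw : IsLogCorrectionWeights K w)
    (x : ℝ) :
    2 * ∑ j, w j * cosTaylor (K + 1) (2 * Real.pi * j * x) =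
      Real.log (2 * Real.pi) - ∑ k ∈ range K, x ^ (2 * (k + 1)) * oddZeta (k + 1) := by
  have hpi := Real.pi_ne_zero
  have hw' (k : ℕ) (hk : k ∈ range (K + 1)) := isLogCorrectionWeights_iff.1 hw ⟨k, mem_range.1 hk⟩
  have h1 : ∑ j, w j * cosTaylor (K + 1) (2 * Real.pi * j * x) =
      ∑ k ∈ range (K + 1), (-1) ^ k * (2 * Real.pi * x) ^ (2 * k) / (2 * k).factorial
        * logCorrectionMoment k := by
    simp only [cosTaylor, mul_sum]
    rw [sum_comm]
    refine sum_congr rfl fun k hk => ?_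
    rw [← hw' k hk, mul_sum]
    refine sum_congr rfl fun j _ => ?_
    rw [show 2 * Real.pi * (j : ℝ) * x = 2 * Real.pi * x * j by ring, mul_pow _ (j : ℝ)]
    ring
  rw [h1, sum_range_succ', mul_add, mul_sum]
  have h2 (k : ℕ) : 2 * ((-1) ^ (k + 1) * (2 * Real.pi * x) ^ (2 * (k + 1))
      / (2 * (k + 1)).factorial * logCorrectionMoment (k + 1))
      = -(x ^ (2 * (k + 1)) * oddZeta (k + 1)) := by
    rw [logCorrectionMoment, if_neg k.succ_ne_zero, mul_pow (2 * Real.pi) x]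
    have hf : (((2 * (k + 1)).factorial : ℕ) : ℝ) ≠ 0 := by positivity
    have hs : ((-1 : ℝ) ^ (k + 1)) * (-1) ^ (k + 1) = 1 := by
      rw [← mul_pow]; norm_num
    field_simp
    linear_combination (-(x ^ (2 * (k + 1)) * oddZeta (k + 1))) * hs
  simp only [h2, sum_neg_distrib]
  simp [logCorrectionMoment]
  ring

/-- The error of the corrected rule for the kernel `-log |2 sin πt|` and the density
`cos 2πnt`, with `2M + 1` nodes. -/
noncomputable def modeDefect {K : ℕ} (w : Fin (K + 1) → ℝ) (M n : ℕ) : ℝ :=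
  (∫ t in (0 : ℝ)..1, logKernel t * Real.cos (2 * Real.pi * n * t))
    - logKernelSum M n / (2 * M + 1)
    - (Real.log (2 * M + 1) - Real.log (2 * Real.pi)
      + 2 * ∑ j, w j * Real.cos (2 * Real.pi * j * (n / (2 * M + 1)))) / (2 * M + 1)

theorem modeDefect_zero {K : ℕ} {w : Fin (K + 1) → ℝ} (hw : IsLogCorrectionWeights K w) (M : ℕ) :
    modeDefect w M 0 = 0 := by
  have h := sum_weights_mul_cosTaylor hw 0
  have h2 : cosTaylor (K + 1) 0 = 1 := by simp [cosTaylor, sum_range_succ']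
  simp only [mul_zero, h2, mul_one] at h
  simp [modeDefect, logKernelSum_zero, integral_logKernel, h]
  ring

theorem abs_modeDefect_le_of_le {K : ℕ} {w : Fin (K + 1) → ℝ} (hw : IsLogCorrectionWeights K w)
    {M n : ℕ} (hn : 1 ≤ n) (hnM : n ≤ M) :
    |modeDefect w M n| ≤ (4 / 3 * oddZeta 1
      + 2 * ∑ j : Fin (K + 1), |w j| * ((2 * Real.pi * j) ^ (2 * K + 2) * Real.exp (2 * Real.pi * j)))
      * (n / (2 * M + 1) : ℝ) ^ (2 * K + 2) / (2 * M + 1) := by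
  have hpi := Real.pi_pos
  have hn' : (0 : ℝ) < n := by exact_mod_cast hn
  have hnM' : (n : ℝ) ≤ M := by exact_mod_cast hnM
  have hN : (0 : ℝ) < 2 * M + 1 := by positivity
  set x : ℝ := n / (2 * M + 1) with hx
  have hx0 : 0 ≤ x := by positivity
  have hx1 : x ≤ 1 / 2 := by rw [hx, div_le_iff₀ hN]; linarith
  set S := logKernelSum M n + Real.log (2 * M + 1) - (2 * M + 1) / (2 * n) with hSdef
  have hS := abs_sub_oddZeta_le hx0 hx1 K (hasSum_logKernelSum hn hnM)
  have hcos : |2 * ∑ j, w j * Real.cos (2 * Real.pi * j * x)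
      - 2 * ∑ j, w j * cosTaylor (K + 1) (2 * Real.pi * j * x)|
      ≤ 2 * ∑ j : Fin (K + 1), |w j| * ((2 * Real.pi * j) ^ (2 * K + 2)
        * Real.exp (2 * Real.pi * j)) * x ^ (2 * K + 2) := by
    rw [← mul_sub, abs_mul, abs_two, ← sum_sub_distrib]
    gcongr
    refine (abs_sum_le_sum_abs _ _).trans (sum_le_sum fun j _ => ?_)
    rw [← mul_sub, abs_mul, mul_assoc |w j|]
    refine mul_le_mul_of_nonneg_left ?_ (abs_nonneg _)
    refine (abs_cos_sub_cosTaylor_le _ _).trans ?_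
    rw [abs_of_nonneg (by positivity), mul_pow _ x, show 2 * (K + 1) = 2 * K + 2 by ring,
      mul_right_comm]
    refine mul_le_mul_of_nonneg_right (mul_le_mul_of_nonneg_left (Real.exp_le_exp.2 ?_)
      (by positivity)) (by positivity)
    exact mul_le_of_le_one_right (by positivity) (by linarith)
  rw [sum_weights_mul_cosTaylor hw] at hcos
  have hmd : modeDefect w M n = -((S - ∑ k ∈ range K, x ^ (2 * (k + 1)) * oddZeta (k + 1))
      + (2 * ∑ j, w j * Real.cos (2 * Real.pi * j * x)
      - (Real.log (2 * Real.pi) - ∑ k ∈ range K, x ^ (2 * (k + 1)) * oddZeta (k + 1))))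
        / (2 * M + 1) := by
    rw [modeDefect, integral_logKernel_mul_cos hn, hSdef, ← hx]
    generalize ∑ j, w j * Real.cos (2 * Real.pi * j * x) = c
    field_simp
    ring
  rw [hmd, abs_div, abs_neg, abs_of_pos hN]
  gcongr
  refine (abs_add_le _ _).trans ((add_le_add hS hcos).trans_eq ?_)
  rw [← sum_mul]
  ring

theorem sum_abs_logKernel_le (M : ℕ) :
    ∑ m ∈ puncturedIndices M, |logKernel (m / (2 * M + 1))| ≤ 2 * Real.log 2 * (2 * M + 1) := by
  have hl2 : 0 < Real.log 2 := Real.log_pos one_lt_two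
  have h (m : ℤ) : |logKernel (m / (2 * M + 1))| ≤ logKernel (m / (2 * M + 1)) + 2 * Real.log 2 := by
    have hb : -Real.log 2 ≤ logKernel (m / (2 * M + 1)) := by
      rw [logKernel, neg_le_neg_iff, ← Real.log_abs]
      rcases eq_or_ne (2 * Real.sin (Real.pi * (m / (2 * M + 1)))) 0 with h0 | h0
      · simp [h0, hl2.le]
      · refine Real.log_le_log (abs_pos.2 h0) ?_
        rw [abs_mul, abs_two]
        linarith [Real.abs_sin_le_one (Real.pi * (m / (2 * M + 1)))]
    rw [abs_le]
    constructor <;> linarith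
  refine (sum_le_sum fun m _ => h m).trans ?_
  rw [sum_add_distrib, sum_logKernel, sum_const, card_erase_of_mem (by simp), Int.card_Icc,
    nsmul_eq_mul]
  have hlog : 0 ≤ Real.log (2 * M + 1) := Real.log_nonneg (by linarith [M.cast_nonneg (α := ℝ)])
  have hc : (((M : ℤ) + 1 - -(M : ℤ)).toNat - 1 : ℕ) = 2 * M := by omega
  rw [hc]
  push_cast
  nlinarith

theorem abs_modeDefect_le {K : ℕ} (w : Fin (K + 1) → ℝ) {M n : ℕ} (hn : 1 ≤ n) :
    |modeDefect w M n| ≤ 1 / 2 + 2 * Real.log 2 + 1 + Real.log (2 * Real.pi) + 2 * ∑ j, |w j| := by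
  have hn' : (1 : ℝ) ≤ n := by exact_mod_cast hn
  have hN1 : (1 : ℝ) ≤ 2 * M + 1 := by linarith [M.cast_nonneg (α := ℝ)]
  have hN : (0 : ℝ) < 2 * M + 1 := by linarith
  have hlp : 0 ≤ Real.log (2 * Real.pi) := Real.log_nonneg (by linarith [Real.pi_gt_three])
  have hlN : 0 ≤ Real.log (2 * M + 1) := Real.log_nonneg hN1
  have h1 : |1 / (2 * (n : ℝ))| ≤ 1 / 2 := by
    rw [abs_of_pos (by positivity)]
    exact one_div_le_one_div_of_le two_pos (by linarith)
  have h2 : |logKernelSum M n / (2 * M + 1)| ≤ 2 * Real.log 2 := by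
    rw [abs_div, abs_of_pos hN, div_le_iff₀ hN]
    refine (abs_sum_le_sum_abs _ _).trans (le_trans (sum_le_sum fun m _ => ?_)
      (sum_abs_logKernel_le M))
    rw [abs_mul]
    exact mul_le_of_le_one_right (abs_nonneg _) (Real.abs_cos_le_one _)
  have h3 : |2 * ∑ j, w j * Real.cos (2 * Real.pi * j * (n / (2 * M + 1)))| ≤ 2 * ∑ j, |w j| := by
    rw [abs_mul, abs_two]
    gcongr
    refine (abs_sum_le_sum_abs _ _).trans (sum_le_sum fun j _ => ?_)
    rw [abs_mul]
    exact mul_le_of_le_one_right (abs_nonneg _) (Real.abs_cos_le_one _)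
  have hw0 : 0 ≤ ∑ j, |w j| := sum_nonneg fun j _ => abs_nonneg _
  have h4 : |(Real.log (2 * M + 1) - Real.log (2 * Real.pi)
      + 2 * ∑ j, w j * Real.cos (2 * Real.pi * j * (n / (2 * M + 1)))) / (2 * M + 1)|
      ≤ 1 + Real.log (2 * Real.pi) + 2 * ∑ j, |w j| := by
    rw [abs_div, abs_of_pos hN, div_le_iff₀ hN]
    have h5 : Real.log (2 * M + 1) ≤ 2 * M + 1 := (Real.log_le_sub_one_of_pos hN).trans (by linarith)
    have h6 := abs_le.1 h3
    rw [abs_le]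
    constructor <;> nlinarith
  rw [modeDefect, integral_logKernel_mul_cos hn]
  rw [abs_le] at *
  constructor <;> linarith

theorem exists_abs_modeDefect_le {K : ℕ} {w : Fin (K + 1) → ℝ} (hw : IsLogCorrectionWeights K w) :
    ∃ C, ∀ M n : ℕ, |modeDefect w M n| ≤ C * (n / (2 * M + 1) : ℝ) ^ (2 * K + 3) := by
  set C₁ := 4 / 3 * oddZeta 1 + 2 * ∑ j : Fin (K + 1), |w j| * ((2 * Real.pi * j) ^ (2 * K + 2)
    * Real.exp (2 * Real.pi * j)) with hC₁
  set C₂ := 1 / 2 + 2 * Real.log 2 + 1 + Real.log (2 * Real.pi) + 2 * ∑ j, |w j| with hC₂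
  have hpi := Real.pi_pos
  have hC₁0 : 0 ≤ C₁ := by
    have : 0 ≤ oddZeta 1 := tsum_nonneg fun q => by positivity
    have : 0 ≤ ∑ j : Fin (K + 1), |w j| * ((2 * Real.pi * j) ^ (2 * K + 2)
      * Real.exp (2 * Real.pi * j)) := sum_nonneg fun j _ => by positivity
    positivity
  have hC₂0 : 0 ≤ C₂ := (abs_nonneg _).trans (abs_modeDefect_le w (M := 0) le_rfl)
  refine ⟨C₁ + C₂ * 2 ^ (2 * K + 3), fun M n => ?_⟩
  have hN : (0 : ℝ) < 2 * M + 1 := by positivity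
  rcases Nat.eq_zero_or_pos n with rfl | hn
  · rw [modeDefect_zero hw, abs_zero]
    positivity
  have hn1 : (1 : ℝ) ≤ n := by exact_mod_cast hn
  rw [add_mul]
  rcases le_or_gt n M with hnM | hnM
  · refine le_add_of_le_of_nonneg ((abs_modeDefect_le_of_le hw hn hnM).trans ?_) (by positivity)
    rw [mul_div_assoc]
    gcongr
    rw [pow_succ _ (2 * K + 2), div_eq_mul_one_div]
    gcongr
  · refine le_add_of_nonneg_of_le (by positivity) ((abs_modeDefect_le w hn).trans ?_)
    rw [mul_assoc, ← mul_pow]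
    refine le_mul_of_one_le_right hC₂0 (one_le_pow₀ ?_)
    have : (M : ℝ) + 1 ≤ n := by exact_mod_cast hnM
    rw [← mul_div_assoc, le_div_iff₀ hN]
    linarith

/-- The exponential `e^{2πint}`. -/
noncomputable def fourierMode (n : ℤ) (t : ℝ) : ℂ :=
  Complex.exp ((2 * Real.pi * n * t : ℝ) * Complex.I)

theorem fourierMode_eq (n : ℤ) (t : ℝ) : fourierMode n t =
    (Real.cos (2 * Real.pi * n * t) : ℂ) + (Real.sin (2 * Real.pi * n * t) : ℂ) * Complex.I := by
  rw [fourierMode, Complex.exp_mul_I, Complex.ofReal_cos, Complex.ofReal_sin]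

theorem norm_fourierMode (n : ℤ) (t : ℝ) : ‖fourierMode n t‖ = 1 :=
  Complex.norm_exp_ofReal_mul_I _

theorem continuous_fourierMode (n : ℤ) : Continuous (fourierMode n) := by
  unfold fourierMode; fun_prop

theorem hasDerivAt_fourierMode (n : ℤ) (t : ℝ) :
    HasDerivAt (fourierMode n) (2 * Real.pi * n * Complex.I * fourierMode n t) t := by
  have h1 : HasDerivAt (fun t : ℝ => 2 * Real.pi * n * t) (2 * Real.pi * n) t := by
    simpa using (hasDerivAt_id t).const_mul (2 * Real.pi * n)
  refine ((h1.ofReal_comp.mul_const Complex.I).cexp).congr_deriv ?_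
  rw [fourierMode]
  push_cast
  ring

theorem fourierMode_intCast (n m : ℤ) : fourierMode n m = 1 := by
  rw [fourierMode, Complex.exp_eq_one_iff]
  exact ⟨n * m, by push_cast; ring⟩

/-- The Fourier coefficients of a function of period `1`. -/
noncomputable def periodicCoeff (g : ℝ → ℂ) (n : ℤ) : ℂ :=
  ∫ t in (0 : ℝ)..1, fourierMode (-n) t * g t

theorem periodicCoeff_deriv {g : ℝ → ℂ} (hg : ContDiff ℝ 1 g) (hper : Function.Periodic g 1)
    (n : ℤ) : periodicCoeff (deriv g) n = 2 * Real.pi * n * Complex.I * periodicCoeff g n := by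
  have h := intervalIntegral.integral_mul_deriv_eq_deriv_mul (a := 0) (b := 1)
    (u := fourierMode (-n)) (v := g)
    (fun t _ => hasDerivAt_fourierMode (-n) t)
    (fun t _ => (hg.differentiable one_ne_zero t).hasDerivAt)
    ((continuous_const.mul (continuous_fourierMode _)).intervalIntegrable _ _)
    ((hg.continuous_deriv le_rfl).intervalIntegrable _ _)
  have h0 : fourierMode (-n) 0 = 1 := by exact_mod_cast fourierMode_intCast (-n) 0
  have h1 : fourierMode (-n) 1 = 1 := by exact_mod_cast fourierMode_intCast (-n) 1
  have hg1 : g 1 = g 0 := by simpa using hper 0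
  rw [periodicCoeff, h, h0, h1, hg1, sub_self, zero_sub, periodicCoeff,
    ← intervalIntegral.integral_neg, ← intervalIntegral.integral_const_mul]
  refine intervalIntegral.integral_congr fun t _ => ?_
  push_cast
  ring

theorem Function.Periodic.deriv_periodic {g : ℝ → ℂ} {c : ℝ} (hg : Function.Periodic g c) :
    Function.Periodic (deriv g) c := by
  intro t
  rw [← deriv_comp_add_const]
  exact congrArg (fun f => deriv f t) (funext hg)

theorem exists_norm_periodicCoeff_mul_pow_le (p : ℕ) {g : ℝ → ℂ} (hg : ContDiff ℝ ∞ g)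
    (hper : Function.Periodic g 1) : ∃ B, ∀ n : ℤ, ‖periodicCoeff g n‖ * |(n : ℝ)| ^ p ≤ B := by
  induction p generalizing g with
  | zero =>
    obtain ⟨B, hB⟩ := isCompact_Icc.exists_bound_of_continuousOn
      (hg.continuous.continuousOn (s := Set.Icc (0 : ℝ) 1))
    refine ⟨B, fun n => ?_⟩
    rw [pow_zero, mul_one]
    have := intervalIntegral.norm_integral_le_of_norm_le_const (a := 0) (b := 1) (C := B)
      (f := fun t => fourierMode (-n) t * g t) fun t ht => by
        rw [Set.uIoc_of_le zero_le_one] at ht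
        rw [norm_mul, norm_fourierMode, one_mul]
        exact hB t ⟨ht.1.le, ht.2⟩
    simpa [periodicCoeff] using this
  | succ p ih =>
    obtain ⟨B, hB⟩ := ih (contDiff_infty_iff_deriv.1 hg).2 hper.deriv_periodic
    refine ⟨B, fun n => le_trans ?_ (hB n)⟩
    rw [periodicCoeff_deriv (hg.of_le (by exact_mod_cast le_top)) hper]
    have h : ‖2 * (Real.pi : ℂ) * n * Complex.I‖ = 2 * Real.pi * |(n : ℝ)| := by
      simp [abs_of_pos Real.pi_pos]
    rw [norm_mul, h, pow_succ]
    have h2 : (1 : ℝ) ≤ 2 * Real.pi := by linarith [Real.pi_gt_three]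
    calc ‖periodicCoeff g n‖ * (|(n : ℝ)| ^ p * |(n : ℝ)|)
        = 1 * (|(n : ℝ)| * ‖periodicCoeff g n‖ * |(n : ℝ)| ^ p) := by ring
      _ ≤ 2 * Real.pi * (|(n : ℝ)| * ‖periodicCoeff g n‖ * |(n : ℝ)| ^ p) := by gcongr
      _ = _ := by ring

theorem summable_norm_periodicCoeff_mul_pow (p : ℕ) {g : ℝ → ℂ} (hg : ContDiff ℝ ∞ g)
    (hper : Function.Periodic g 1) : Summable fun n : ℤ => ‖periodicCoeff g n‖ * |(n : ℝ)| ^ p := by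
  obtain ⟨B, hB⟩ := exists_norm_periodicCoeff_mul_pow_le (p + 2) hg hper
  refine Summable.of_norm_bounded_eventually
    ((Real.summable_one_div_int_pow.2 one_lt_two).mul_left B) ?_
  filter_upwards [(Set.finite_singleton (0 : ℤ)).compl_mem_cofinite] with n hn
  have hn' : (n : ℝ) ≠ 0 := by exact_mod_cast hn
  rw [Real.norm_of_nonneg (by positivity), mul_one_div, le_div_iff₀ (by positivity),
    ← sq_abs (n : ℝ), mul_assoc, ← pow_add]
  exact hB n

theorem summable_norm_periodicCoeff {g : ℝ → ℂ} (hg : ContDiff ℝ ∞ g)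
    (hper : Function.Periodic g 1) : Summable fun n : ℤ => ‖periodicCoeff g n‖ := by
  simpa using summable_norm_periodicCoeff_mul_pow 0 hg hper

theorem hasSum_periodicCoeff_mul_fourierMode {g : ℝ → ℂ} (hg : ContDiff ℝ ∞ g)
    (hper : Function.Periodic g 1) (t : ℝ) :
    HasSum (fun n : ℤ => periodicCoeff g n * fourierMode n t) (g t) := by
  have : Fact ((0 : ℝ) < 1) := ⟨zero_lt_one⟩
  let f : C(AddCircle (1 : ℝ), ℂ) := ⟨hper.lift, hg.continuous.quotient_lift _⟩
  have hmode (n : ℤ) (x : ℝ) : fourier n (x : AddCircle (1 : ℝ)) = fourierMode n x := by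
    rw [fourier_coe_apply, fourierMode]
    congr 1
    push_cast
    ring
  have hcoeff (n : ℤ) : fourierCoeff f n = periodicCoeff g n := by
    rw [fourierCoeff_eq_intervalIntegral f n 0, periodicCoeff]
    simp only [hmode, zero_add, div_one, one_smul, smul_eq_mul]
    rfl
  have hs : Summable (fourierCoeff f) := by
    refine Summable.of_norm ?_
    simp only [hcoeff]
    exact summable_norm_periodicCoeff hg hper
  have h := has_pointwise_sum_fourier_series_of_summable hs (t : AddCircle (1 : ℝ))
  simp only [hcoeff, hmode, smul_eq_mul] at h
  exact h

theorem IntervalIntegrable.complex_ofReal {k : ℝ → ℝ} {a b : ℝ}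
    (hk : IntervalIntegrable k MeasureTheory.volume a b) :
    IntervalIntegrable (fun t => (k t : ℂ)) MeasureTheory.volume a b :=
  ⟨MeasureTheory.Integrable.ofReal hk.1, MeasureTheory.Integrable.ofReal hk.2⟩

theorem hasSum_periodicCoeff_mul_integral {g : ℝ → ℂ} (hg : ContDiff ℝ ∞ g)
    (hper : Function.Periodic g 1) {k : ℝ → ℝ}
    (hk : IntervalIntegrable k MeasureTheory.volume 0 1) :
    HasSum (fun n : ℤ => periodicCoeff g n * ∫ t in (0 : ℝ)..1, (k t : ℂ) * fourierMode n t)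
      (∫ t in (0 : ℝ)..1, (k t : ℂ) * g t) := by
  have hk' : IntervalIntegrable (fun t => (k t : ℂ)) MeasureTheory.volume 0 1 := hk.complex_ofReal
  have hF (n : ℤ) : IntervalIntegrable
      (fun t => periodicCoeff g n * ((k t : ℂ) * fourierMode n t)) MeasureTheory.volume 0 1 :=
    (hk'.mul_continuousOn (continuous_fourierMode n).continuousOn).const_mul _
  simp only [intervalIntegral.integral_of_le zero_le_one,
    intervalIntegrable_iff_integrableOn_Ioc_of_le zero_le_one, MeasureTheory.IntegrableOn] at hF ⊢
  have h := MeasureTheory.hasSum_integral_of_summable_integral_norm hF ?_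
  · simp only [MeasureTheory.integral_const_mul] at h
    have e (t : ℝ) : ∑' n : ℤ, periodicCoeff g n * ((k t : ℂ) * fourierMode n t)
        = (k t : ℂ) * g t := by
      rw [← ((hasSum_periodicCoeff_mul_fourierMode hg hper t).mul_left (k t : ℂ)).tsum_eq]
      exact tsum_congr fun n => by ring
    simp only [e] at h
    exact h
  · simp only [norm_mul, norm_fourierMode, mul_one, MeasureTheory.integral_const_mul]
    exact (summable_norm_periodicCoeff hg hper).mul_right _

theorem norm_le_of_hasSum_of_modes {g : ℝ → ℂ} (hg : ContDiff ℝ ∞ g)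
    (hper : Function.Periodic g 1) (p : ℕ) {D : ℕ → ℂ} {l : ℕ → ℤ → ℂ} {C : ℝ}
    (hD : ∀ M, HasSum (fun n => periodicCoeff g n * l M n) (D M))
    (hl : ∀ M n, ‖l M n‖ ≤ C * (|(n : ℝ)| / (2 * M + 1)) ^ p) :
    ∃ C', ∀ M : ℕ, ‖D M‖ ≤ C' / (2 * M + 1) ^ p := by
  have hs := summable_norm_periodicCoeff_mul_pow p hg hper
  refine ⟨(∑' n : ℤ, ‖periodicCoeff g n‖ * |(n : ℝ)| ^ p) * C, fun M => ?_⟩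
  rw [mul_div_assoc, ← (hD M).tsum_eq]
  refine tsum_of_norm_bounded (hs.hasSum.mul_right _) fun n => ?_
  rw [norm_mul]
  calc ‖periodicCoeff g n‖ * ‖l M n‖
      ≤ ‖periodicCoeff g n‖ * (C * (|(n : ℝ)| / (2 * M + 1)) ^ p) := by gcongr; exact hl M n
    _ = _ := by rw [div_pow]; ring

theorem fourierMode_add_neg (n : ℤ) (t : ℝ) :
    fourierMode n t + fourierMode n (-t) = 2 * (Real.cos (2 * Real.pi * n.natAbs * t) : ℂ) := by
  have h : Real.cos (2 * Real.pi * n * t) = Real.cos (2 * Real.pi * n.natAbs * t) := by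
    rcases Int.natAbs_eq n with h | h
    · conv_lhs => rw [h]
      simp
    · conv_lhs => rw [h]
      rw [← Real.cos_neg, Int.cast_neg, Int.cast_natCast]
      congr 1
      ring
  rw [fourierMode_eq, fourierMode_eq, mul_neg, Real.cos_neg, Real.sin_neg, h]
  push_cast
  ring

theorem sum_puncturedIndices_mul_fourierMode (k : ℝ → ℝ) (hk : ∀ t, k (-t) = k t) (M : ℕ) (n : ℤ) :
    ∑ m ∈ puncturedIndices M, (k (m / (2 * M + 1)) : ℂ) * fourierMode n (m / (2 * M + 1))
      = ((∑ m ∈ puncturedIndices M, k (m / (2 * M + 1))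
        * Real.cos (2 * Real.pi * n.natAbs * (m / (2 * M + 1))) : ℝ) : ℂ) := by
  push_cast
  rw [sum_puncturedIndices_eq, sum_puncturedIndices_eq]
  refine sum_congr rfl fun i _ => ?_
  have h := fourierMode_add_neg n ((i + 1) / (2 * M + 1))
  push_cast [neg_div, hk, mul_neg, Complex.cos_neg] at h ⊢
  rw [← mul_add, h]
  ring

theorem integral_logKernel_mul_fourierMode (n : ℤ) :
    ∫ t in (0 : ℝ)..1, (logKernel t : ℂ) * fourierMode n t
      = ((∫ t in (0 : ℝ)..1, logKernel t * Real.cos (2 * Real.pi * n.natAbs * t) : ℝ) : ℂ) := by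
  have hc : IntervalIntegrable (fun t => ((logKernel t * Real.cos (2 * Real.pi * n.natAbs * t) : ℝ) : ℂ))
      MeasureTheory.volume 0 1 :=
    IntervalIntegrable.complex_ofReal
      ((intervalIntegrable_logKernel 0 1).mul_continuousOn (by fun_prop))
  have hs : IntervalIntegrable (fun t => ((logKernel t * Real.sin (2 * Real.pi * n * t) : ℝ) : ℂ))
      MeasureTheory.volume 0 1 :=
    IntervalIntegrable.complex_ofReal
      ((intervalIntegrable_logKernel 0 1).mul_continuousOn (by fun_prop))
  have h (t : ℝ) : (logKernel t : ℂ) * fourierMode n t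
      = ((logKernel t * Real.cos (2 * Real.pi * n.natAbs * t) : ℝ) : ℂ)
        + ((logKernel t * Real.sin (2 * Real.pi * n * t) : ℝ) : ℂ) * Complex.I := by
    have h1 := fourierMode_add_neg n t
    rw [fourierMode_eq, fourierMode_eq, mul_neg, Real.cos_neg, Real.sin_neg] at h1
    rw [fourierMode_eq]
    push_cast at h1 ⊢
    linear_combination (logKernel t : ℂ) / 2 * h1
  simp only [h]
  rw [intervalIntegral.integral_add hc (hs.mul_const _), intervalIntegral.integral_mul_const,
    intervalIntegral.integral_ofReal, intervalIntegral.integral_ofReal, integral_logKernel_mul_sin]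
  simp

/-- The error of the corrected punctured rule with `2M + 1` nodes on a period, for the kernel
`-log |2 sin πt|`. -/
noncomputable def logRuleDefect {K : ℕ} (w : Fin (K + 1) → ℝ) (g : ℝ → ℂ) (M : ℕ) : ℂ :=
  (∫ t in (0 : ℝ)..1, (logKernel t : ℂ) * g t)
    - (∑ m ∈ puncturedIndices M, (logKernel (m / (2 * M + 1)) : ℂ) * g (m / (2 * M + 1)))
      / (2 * M + 1)
    - ((Real.log (2 * M + 1) - Real.log (2 * Real.pi) : ℝ) * g 0
      + ∑ j : Fin (K + 1), (w j : ℂ) * (g (j / (2 * M + 1)) + g (-(j / (2 * M + 1)))))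
      / (2 * M + 1)

theorem logRuleDefect_fourierMode {K : ℕ} (w : Fin (K + 1) → ℝ) (M : ℕ) (n : ℤ) :
    logRuleDefect w (fourierMode n) M = (modeDefect w M n.natAbs : ℂ) := by
  have h0 : fourierMode n 0 = 1 := by exact_mod_cast fourierMode_intCast n 0
  rw [logRuleDefect, integral_logKernel_mul_fourierMode,
    sum_puncturedIndices_mul_fourierMode _ logKernel_neg, h0, modeDefect, logKernelSum]
  simp only [fourierMode_add_neg]
  rw [mul_sum]
  have h : ∀ j : Fin (K + 1), 2 * Real.pi * (n.natAbs : ℝ) * ((j : ℝ) / (2 * M + 1))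
      = 2 * Real.pi * j * (n.natAbs / (2 * M + 1)) := fun j => by ring
  simp only [h]
  have h' : ∑ j : Fin (K + 1), (w j : ℂ) * (2 * ((Real.cos (2 * Real.pi * j
      * (n.natAbs / (2 * M + 1))) : ℝ) : ℂ)) = ∑ j : Fin (K + 1), 2 * ((w j : ℂ) *
      ((Real.cos (2 * Real.pi * j * (n.natAbs / (2 * M + 1))) : ℝ) : ℂ)) :=
    sum_congr rfl fun j _ => by ring
  rw [h', mul_one]
  push_cast
  rfl

theorem hasSum_logRuleDefect {K : ℕ} (w : Fin (K + 1) → ℝ) {g : ℝ → ℂ} (hg : ContDiff ℝ ∞ g)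
    (hper : Function.Periodic g 1) (M : ℕ) :
    HasSum (fun n => periodicCoeff g n * logRuleDefect w (fourierMode n) M)
      (logRuleDefect w g M) := by
  have hpt := hasSum_periodicCoeff_mul_fourierMode hg hper
  have h1 := hasSum_periodicCoeff_mul_integral hg hper (intervalIntegrable_logKernel 0 1)
  have h2 := (hasSum_sum (s := puncturedIndices M) fun m _ =>
    (hpt (m / (2 * M + 1))).mul_left (logKernel (m / (2 * M + 1)) : ℂ)).div_const (2 * M + 1 : ℂ)
  have h3 := (hasSum_sum (s := (univ : Finset (Fin (K + 1)))) fun j _ =>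
    ((hpt (j / (2 * M + 1))).add (hpt (-(j / (2 * M + 1))))).mul_left (w j : ℂ))
  have h4 := (((hpt 0).mul_left
    ((Real.log (2 * M + 1) - Real.log (2 * Real.pi) : ℝ) : ℂ)).add h3).div_const (2 * M + 1 : ℂ)
  refine Eq.mpr (congrArg (fun f => HasSum f _) (funext fun n => ?_)) ((h1.sub h2).sub h4)
  have e1 : ∑ m ∈ puncturedIndices M, (logKernel (m / (2 * M + 1)) : ℂ)
      * (periodicCoeff g n * fourierMode n (m / (2 * M + 1))) = periodicCoeff g n
      * ∑ m ∈ puncturedIndices M, (logKernel (m / (2 * M + 1)) : ℂ)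
        * fourierMode n (m / (2 * M + 1)) := by
    rw [mul_sum]
    exact sum_congr rfl fun m _ => by ring
  have e2 : ∑ j : Fin (K + 1), (w j : ℂ) * (periodicCoeff g n * fourierMode n (j / (2 * M + 1))
      + periodicCoeff g n * fourierMode n (-(j / (2 * M + 1)))) = periodicCoeff g n
      * ∑ j : Fin (K + 1), (w j : ℂ) * (fourierMode n (j / (2 * M + 1))
        + fourierMode n (-(j / (2 * M + 1)))) := by
    rw [mul_sum]
    exact sum_congr rfl fun j _ => by ring
  rw [e1, e2, logRuleDefect]
  ring

theorem exists_norm_logRuleDefect_le {K : ℕ} {w : Fin (K + 1) → ℝ} (hw : IsLogCorrectionWeights K w)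
    {g : ℝ → ℂ} (hg : ContDiff ℝ ∞ g) (hper : Function.Periodic g 1) :
    ∃ C, ∀ M : ℕ, ‖logRuleDefect w g M‖ ≤ C / (2 * M + 1) ^ (2 * K + 3) := by
  obtain ⟨C, hC⟩ := exists_abs_modeDefect_le hw
  refine norm_le_of_hasSum_of_modes hg hper _ (C := C) (hasSum_logRuleDefect w hg hper) fun M n => ?_
  rw [logRuleDefect_fourierMode, Complex.norm_real, Real.norm_eq_abs]
  refine (hC M n.natAbs).trans_eq ?_
  rw [Nat.cast_natAbs, Int.cast_abs]

/-- The error of the trapezoidal rule with `2M + 1` nodes on a period. -/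
noncomputable def trapezoidDefect (g : ℝ → ℂ) (M : ℕ) : ℂ :=
  (∫ t in (0 : ℝ)..1, g t)
    - (g 0 + ∑ m ∈ puncturedIndices M, g (m / (2 * M + 1))) / (2 * M + 1)

theorem integral_fourierMode (n : ℤ) :
    ∫ t in (0 : ℝ)..1, fourierMode n t = if n = 0 then 1 else 0 := by
  split_ifs with hn
  · simp [hn, fourierMode]
  · have h := periodicCoeff_deriv (g := fun _ => 1) contDiff_const (fun _ => rfl) (-n)
    simp only [deriv_const', periodicCoeff, neg_neg, mul_zero, mul_one,
      intervalIntegral.integral_zero] at h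
    have hn' : (n : ℂ) ≠ 0 := by exact_mod_cast hn
    simpa [Real.pi_ne_zero, hn'] using h.symm

theorem trapezoidDefect_fourierMode (M : ℕ) (n : ℤ) :
    trapezoidDefect (fourierMode n) M
      = (if n = 0 then 1 else 0) - (if (2 * M + 1 : ℤ) ∣ n then 1 else 0) := by
  have h0 : fourierMode n 0 = 1 := by exact_mod_cast fourierMode_intCast n 0
  have h1 := sum_puncturedIndices_mul_fourierMode (fun _ => 1) (fun _ => rfl) M n
  have h2 := sum_cos_eq M n.natAbs
  have hN : (2 * (M : ℂ) + 1) ≠ 0 := by exact_mod_cast (show (2 * (M : ℝ) + 1) ≠ 0 by positivity)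
  simp only [Int.cast_natCast] at h2
  simp only [Complex.ofReal_one, one_mul, h2] at h1
  rw [trapezoidDefect, integral_fourierMode, h0, h1]
  simp only [Int.dvd_natAbs]
  split_ifs <;> push_cast <;> field_simp <;> ring

theorem exists_norm_trapezoidDefect_le {g : ℝ → ℂ} (hg : ContDiff ℝ ∞ g)
    (hper : Function.Periodic g 1) (p : ℕ) :
    ∃ C, ∀ M : ℕ, ‖trapezoidDefect g M‖ ≤ C / (2 * M + 1) ^ p := by
  refine norm_le_of_hasSum_of_modes hg hper p (l := fun M n => trapezoidDefect (fourierMode n) M)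
    (C := 1) (fun M => ?_) fun M n => ?_
  · have hpt := hasSum_periodicCoeff_mul_fourierMode hg hper
    have h1 := hasSum_periodicCoeff_mul_integral hg hper (k := fun _ => 1) (by simp)
    simp only [Complex.ofReal_one, one_mul] at h1
    have h2 := ((hpt 0).add (hasSum_sum (s := puncturedIndices M) fun m _ =>
      (hpt (m / (2 * M + 1))))).div_const (2 * M + 1 : ℂ)
    refine Eq.mpr (congrArg (fun f => HasSum f _) (funext fun n => ?_)) (h1.sub h2)
    rw [trapezoidDefect, ← mul_sum]
    ring
  · have hN : (0 : ℝ) < 2 * M + 1 := by positivity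
    rw [trapezoidDefect_fourierMode, one_mul]
    rcases eq_or_ne n 0 with rfl | hn
    · simp only [↓reduceIte, dvd_zero, sub_self, norm_zero]
      positivity
    · rw [if_neg hn]
      split_ifs with hd
      · rw [zero_sub, norm_neg, norm_one]
        refine one_le_pow₀ ((one_le_div hN).2 ?_)
        have := Int.le_of_dvd (abs_pos.2 hn) ((dvd_abs _ _).2 hd)
        exact_mod_cast this
      · simp only [sub_zero, norm_zero]
        positivity

section Hadamard

variable {E : Type*} [NormedAddCommGroup E] [NormedSpace ℝ E]

/-- The moment integral `∫₀¹ s^k f(st) ds`. -/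
noncomputable def dilationMoment (k : ℕ) (f : ℝ → E) (t : ℝ) : E :=
  ∫ s in (0 : ℝ)..1, s ^ k • f (s * t)

theorem hasDerivAt_dilationMoment (k : ℕ) {f : ℝ → E} (hf : ContDiff ℝ 1 f) (t : ℝ) :
    HasDerivAt (dilationMoment k f) (dilationMoment (k + 1) (deriv f) t) t := by
  have hf' : Continuous (deriv f) := hf.continuous_deriv le_rfl
  have hfc := hf.continuous
  obtain ⟨B, hB⟩ := isCompact_Icc.exists_bound_of_continuousOn
    (hf'.continuousOn (s := Set.Icc (-(|t| + 1)) (|t| + 1)))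
  refine (intervalIntegral.hasDerivAt_integral_of_dominated_loc_of_deriv_le
    (F := fun x s => s ^ k • f (s * x)) (F' := fun x s => s ^ (k + 1) • deriv f (s * x))
    (bound := fun _ => B) (Metric.ball_mem_nhds t one_pos) ?_ ?_ ?_ ?_ ?_ ?_).2
  · exact Eventually.of_forall fun x => Continuous.aestronglyMeasurable (by fun_prop)
  · exact Continuous.intervalIntegrable (by fun_prop) _ _
  · exact Continuous.aestronglyMeasurable (by fun_prop)
  · refine Eventually.of_forall fun s hs x hx => ?_
    rw [Set.uIoc_of_le zero_le_one] at hs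
    rw [norm_smul, norm_pow, Real.norm_of_nonneg hs.1.le]
    have hx1 : |x| ≤ |t| + 1 := by
      rw [Metric.mem_ball, Real.dist_eq] at hx
      have := abs_add_le (x - t) t
      rw [sub_add_cancel] at this
      linarith
    have hsx : |s * x| ≤ |t| + 1 := by
      rw [abs_mul, abs_of_pos hs.1]
      exact (mul_le_of_le_one_left (abs_nonneg x) hs.2).trans hx1
    have h := hB (s * x) (abs_le.1 hsx)
    calc s ^ (k + 1) * ‖deriv f (s * x)‖ ≤ 1 * ‖deriv f (s * x)‖ := by
          gcongr
          exact pow_le_one₀ hs.1.le hs.2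
      _ ≤ B := by rwa [one_mul]
  · simp
  · refine Eventually.of_forall fun s _ x _ => ?_
    have h1 : HasDerivAt (fun x => s * x) s x := by simpa using (hasDerivAt_id x).const_mul s
    have h2 := ((hf.differentiable one_ne_zero (s * x)).hasDerivAt.scomp x h1).const_smul (s ^ k)
    rw [smul_smul, ← pow_succ] at h2
    exact h2

theorem contDiff_dilationMoment (k : ℕ) {f : ℝ → E} (hf : ContDiff ℝ ∞ f) :
    ContDiff ℝ ∞ (dilationMoment k f) := by
  rw [contDiff_infty]
  intro n
  induction n generalizing k f with
  | zero =>
    exact contDiff_zero.2 (continuous_iff_continuousAt.2 fun t =>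
      (hasDerivAt_dilationMoment k (hf.of_le (by exact_mod_cast le_top)) t).continuousAt)
  | succ n ih =>
    have hd := hasDerivAt_dilationMoment k (hf.of_le (m := 1) (by exact_mod_cast le_top))
    push_cast
    rw [contDiff_succ_iff_deriv]
    refine ⟨fun t => (hd t).differentiableAt, by simp, ?_⟩
    rw [show deriv (dilationMoment k f) = dilationMoment (k + 1) (deriv f) from
      funext fun t => (hd t).deriv]
    exact ih (k + 1) (contDiff_infty_iff_deriv.1 hf).2

/-- Hadamard's lemma in one variable. -/
theorem exists_contDiff_smul_eq_sub [CompleteSpace E] {f : ℝ → E} (hf : ContDiff ℝ ∞ f) :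
    ∃ V : ℝ → E, ContDiff ℝ ∞ V ∧ V 0 = deriv f 0 ∧ ∀ t, f t - f 0 = t • V t := by
  have hf' := (contDiff_infty_iff_deriv.1 hf).2
  refine ⟨dilationMoment 0 (deriv f), contDiff_dilationMoment 0 hf', by simp [dilationMoment],
    fun t => ?_⟩
  have h := intervalIntegral.integral_eq_sub_of_hasDerivAt (a := 0) (b := 1)
    (f := fun s => f (s * t)) (f' := fun s => t • deriv f (s * t)) (fun s _ => by
      have h1 : HasDerivAt (fun s => s * t) t s := by simpa using (hasDerivAt_id s).mul_const t
      exact (hf.differentiable (by simp) (s * t)).hasDerivAt.scomp s h1)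
    (Continuous.intervalIntegrable (by have := hf'.continuous; fun_prop) _ _)
  simp only [one_mul, zero_mul, intervalIntegral.integral_smul] at h
  simp [dilationMoment, h]

end Hadamard

section LogDistance

variable {E : Type*} [NormedAddCommGroup E] [InnerProductSpace ℝ E]

/-- The smooth part of the logarithm of the distance from `σ 0` to `σ t`. -/
noncomputable def logDistRegular (σ : ℝ → E) (t : ℝ) : ℝ :=
  if Real.sin (Real.pi * t) = 0 then Real.log (‖deriv σ 0‖ / (2 * Real.pi))
  else Real.log ‖σ 0 - σ t‖ + logKernel t

theorem neg_log_norm_sub (σ : ℝ → E) {t : ℝ} (ht : Real.sin (Real.pi * t) ≠ 0) :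
    -Real.log ‖σ 0 - σ t‖ = logKernel t - logDistRegular σ t := by
  rw [logDistRegular, if_neg ht]; ring

theorem logDistRegular_zero (σ : ℝ → E) :
    logDistRegular σ 0 = Real.log (‖deriv σ 0‖ / (2 * Real.pi)) := by
  simp [logDistRegular]

theorem logDistRegular_periodic {σ : ℝ → E} (hper : Function.Periodic σ 1) :
    Function.Periodic (logDistRegular σ) 1 := by
  intro t
  rw [logDistRegular, logDistRegular, hper, logKernel_periodic, mul_add, mul_one, Real.sin_add_pi]
  simp only [neg_eq_zero]

theorem contDiffAt_logDistRegular_zero [CompleteSpace E] {σ : ℝ → E} (hσ : ContDiff ℝ ∞ σ)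
    (hreg : deriv σ 0 ≠ 0) : ContDiffAt ℝ ∞ (logDistRegular σ) 0 := by
  obtain ⟨V, hV, hV0, hVt⟩ := exists_contDiff_smul_eq_sub hσ
  obtain ⟨S, hS, hS0, hSt⟩ := exists_contDiff_smul_eq_sub
    (f := fun t : ℝ => 2 * Real.sin (Real.pi * t)) (by fun_prop)
  have hd : deriv (fun t : ℝ => 2 * Real.sin (Real.pi * t)) 0 = 2 * Real.pi := by
    have h1 : HasDerivAt (fun t => Real.pi * t) Real.pi 0 := by
      simpa using (hasDerivAt_id (0 : ℝ)).const_mul Real.pi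
    simpa using (h1.sin.const_mul 2).deriv
  rw [hd] at hS0
  have hV0' : V 0 ≠ 0 := by rwa [hV0]
  have hS0' : S 0 ≠ 0 := by rw [hS0]; have := Real.pi_pos; positivity
  have hsm : ContDiffAt ℝ ∞ (fun t => Real.log ‖V t‖ - Real.log (S t)) 0 :=
    ((hV.contDiffAt.norm ℝ hV0').log (norm_ne_zero_iff.2 hV0')).sub (hS.contDiffAt.log hS0')
  refine hsm.congr_of_eventuallyEq ?_
  filter_upwards [hV.continuous.continuousAt.eventually_ne hV0',
    hS.continuous.continuousAt.eventually_ne hS0'] with t h1 h2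
  have hs : 2 * Real.sin (Real.pi * t) = t * S t := by simpa using hSt t
  rcases eq_or_ne t 0 with rfl | ht
  · rw [logDistRegular_zero, hV0, hS0,
      Real.log_div (norm_ne_zero_iff.2 hreg) (by have := Real.pi_pos; positivity)]
  · have hne : Real.sin (Real.pi * t) ≠ 0 := fun h => by
      rw [h, mul_zero] at hs
      exact mul_ne_zero ht h2 hs.symm
    rw [logDistRegular, if_neg hne, logKernel, hs, norm_sub_rev, hVt, norm_smul,
      Real.log_mul (norm_ne_zero_iff.2 ht) (norm_ne_zero_iff.2 h1), Real.log_mul ht h2,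
      Real.norm_eq_abs, Real.log_abs]
    ring

theorem contDiff_logDistRegular [CompleteSpace E] {σ : ℝ → E} (hσ : ContDiff ℝ ∞ σ)
    (hper : Function.Periodic σ 1)
    (hreg : deriv σ 0 ≠ 0) (hsimple : ∀ t, |t| ≤ 1 / 2 → σ t = σ 0 → t = 0) :
    ContDiff ℝ ∞ (logDistRegular σ) := by
  rw [contDiff_iff_contDiffAt]
  intro t
  by_cases ht : Real.sin (Real.pi * t) = 0
  · obtain ⟨m, hm⟩ := Real.sin_eq_zero_iff.1 ht
    have htm : t = m := by
      rw [mul_comm] at hm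
      exact (mul_left_cancel₀ Real.pi_ne_zero hm).symm
    have hshift : logDistRegular σ = fun s => logDistRegular σ (s - m) := by
      funext s
      simpa using ((logDistRegular_periodic hper).sub_zsmul_eq m (x := s)).symm
    rw [hshift]
    refine ContDiffAt.comp t (g := logDistRegular σ) ?_ (by fun_prop)
    rw [htm, sub_self]
    exact contDiffAt_logDistRegular_zero hσ hreg
  · have hne : σ 0 - σ t ≠ 0 := by
      intro h
      have h1 : σ (t - round t) = σ 0 := by
        have := hper.sub_zsmul_eq (round t) (x := t)
        rw [zsmul_one] at this
        rw [this]
        exact (sub_eq_zero.1 h).symm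
      have h2 := sub_eq_zero.1 (hsimple _ (abs_sub_round t) h1)
      apply ht
      rw [h2, mul_comm]
      exact Real.sin_int_mul_pi _
    have hsm : ContDiffAt ℝ ∞ (fun t => Real.log ‖σ 0 - σ t‖
        + -Real.log (2 * Real.sin (Real.pi * t))) t := by
      refine ContDiffAt.add (ContDiffAt.log (ContDiffAt.norm ℝ ?_ hne) (norm_ne_zero_iff.2 hne))
        (ContDiffAt.neg (ContDiffAt.log (by fun_prop) (mul_ne_zero two_ne_zero ht)))
      exact contDiffAt_const.sub hσ.contDiffAt
    refine hsm.congr_of_eventuallyEq ?_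
    have hcont : ContinuousAt (fun t => Real.sin (Real.pi * t)) t := by fun_prop
    filter_upwards [hcont.eventually_ne ht] with s hs
    rw [logDistRegular, if_neg hs, logKernel]

end LogDistance

theorem RCLike.norm_map_complex {𝕜 : Type*} [RCLike 𝕜] (z : 𝕜) : ‖RCLike.map 𝕜 ℂ z‖ = ‖z‖ := by
  rw [← sq_eq_sq₀ (norm_nonneg _) (norm_nonneg _), Complex.sq_norm, Complex.normSq_apply,
    RCLike.norm_sq_eq_def]
  simp [RCLike.map_apply]

theorem sin_pi_mul_ne_zero_of_abs_le {t : ℝ} (ht : |t| ≤ 1 / 2) (h0 : t ≠ 0) :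
    Real.sin (Real.pi * t) ≠ 0 := by
  have hpi := Real.pi_pos
  have h := abs_le.1 ht
  intro hs
  have := (Real.sin_eq_zero_iff_of_lt_of_lt (by nlinarith) (by nlinarith)).1 hs
  exact mul_ne_zero hpi.ne' h0 this

theorem gridStep_eq (a : ℝ) (M : ℕ) : gridStep a M = 2 * a / (2 * M + 1) := by
  have : (2 * (M : ℝ) + 1) ≠ 0 := by positivity
  rw [gridStep]
  field_simp

theorem laplaceIntegrand_two_mul {n : ℕ} {𝕜 : Type*} [RCLike 𝕜] (a : ℝ)
    (ρ : ℝ → EuclideanSpace ℝ (Fin n)) (τ : ℝ → 𝕜) {t : ℝ} (ht : Real.sin (Real.pi * t) ≠ 0) :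
    RCLike.map 𝕜 ℂ (laplaceIntegrand ρ τ (2 * a * t)) =
      ((logKernel t : ℂ) - (logDistRegular (fun t => ρ (2 * a * t)) t : ℂ))
        * RCLike.map 𝕜 ℂ (weightedDensity ρ τ (2 * a * t)) := by
  have h := neg_log_norm_sub (fun t => ρ (2 * a * t)) ht
  rw [mul_zero] at h
  rw [laplaceIntegrand, targetDist, h, map_smul, Complex.real_smul]
  push_cast
  rfl

theorem Function.Periodic.comp_mul_left_one {E : Type*} {f : ℝ → E} {c : ℝ}
    (hf : Function.Periodic f c) : Function.Periodic (fun t => f (c * t)) 1 := fun t => by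
  show f (c * (t + 1)) = _
  rw [mul_add, mul_one, hf]

theorem weightedDensity_periodic {n : ℕ} {𝕜 : Type*} [RCLike 𝕜] {c : ℝ}
    {ρ : ℝ → EuclideanSpace ℝ (Fin n)} {τ : ℝ → 𝕜} (hρ : Function.Periodic ρ c)
    (hτ : Function.Periodic τ c) : Function.Periodic (weightedDensity ρ τ) c := by
  intro x
  have h : deriv ρ (x + c) = deriv ρ x := by
    rw [← deriv_comp_add_const]
    exact congrArg (fun f => deriv f x) (funext hρ)
  rw [weightedDensity, weightedDensity, h, hτ]

theorem intervalIntegrable_laplaceIntegrand {n : ℕ} {𝕜 : Type*} [RCLike 𝕜] {a : ℝ} (ha : 0 < a)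
    {ρ : ℝ → EuclideanSpace ℝ (Fin n)} {τ : ℝ → 𝕜}
    (hq : Continuous (logDistRegular fun t => ρ (2 * a * t)))
    (hτ : Continuous (weightedDensity ρ τ)) :
    IntervalIntegrable (laplaceIntegrand ρ τ) MeasureTheory.volume (-a) a := by
  set q := logDistRegular fun t => ρ (2 * a * t) with hqdef
  have h1 : IntervalIntegrable (fun x => logKernel ((2 * a)⁻¹ * x)) MeasureTheory.volume (-a) a := by
    have h : AnalyticOnNhd ℝ (fun x : ℝ => 2 * Real.sin (Real.pi * ((2 * a)⁻¹ * x)))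
        (Set.uIcc (-a) a) := fun t _ => by fun_prop
    exact h.meromorphicOn.intervalIntegrable_log.neg
  have h2 : IntervalIntegrable (fun x => q ((2 * a)⁻¹ * x)) MeasureTheory.volume (-a) a :=
    Continuous.intervalIntegrable (by fun_prop) _ _
  refine ((h1.sub h2).smul_continuousOn hτ.continuousOn).congr_ae ?_
  refine (MeasureTheory.ae_restrict_iff' measurableSet_uIoc).2 ?_
  have h0 : ∀ᵐ x : ℝ, x ∉ ({0} : Set ℝ) := (Set.countable_singleton 0).ae_notMem _
  filter_upwards [h0] with x hx hxa
  rw [Set.uIoc_of_le (by linarith)] at hxa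
  have hs : Real.sin (Real.pi * ((2 * a)⁻¹ * x)) ≠ 0 := by
    refine sin_pi_mul_ne_zero_of_abs_le ?_ (mul_ne_zero (by positivity) hx)
    rw [abs_mul, abs_of_pos (by positivity : 0 < (2 * a)⁻¹), inv_mul_le_iff₀ (by positivity)]
    have := abs_le.2 ⟨hxa.1.le, hxa.2⟩
    linarith
  have h3 := neg_log_norm_sub (fun t => ρ (2 * a * t)) hs
  rw [mul_zero, mul_inv_cancel_left₀ (by positivity : 2 * a ≠ 0)] at h3
  show (logKernel _ - q _) • _ = _
  rw [laplaceIntegrand, targetDist, h3]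

theorem map_laplaceSLP {n : ℕ} {𝕜 : Type*} [RCLike 𝕜] {a : ℝ} (ha : 0 < a)
    {ρ : ℝ → EuclideanSpace ℝ (Fin n)} {τ : ℝ → 𝕜}
    (hρ : Function.Periodic (fun t => ρ (2 * a * t)) 1)
    (hτ : Function.Periodic (fun t => weightedDensity ρ τ (2 * a * t)) 1)
    (hq : Continuous (logDistRegular fun t => ρ (2 * a * t)))
    (hτc : Continuous (weightedDensity ρ τ)) :
    RCLike.map 𝕜 ℂ (laplaceSLP a ρ τ) =
      2 * a * ((∫ t in (0 : ℝ)..1,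
          (logKernel t : ℂ) * RCLike.map 𝕜 ℂ (weightedDensity ρ τ (2 * a * t)))
        - ∫ t in (0 : ℝ)..1, (logDistRegular (fun t => ρ (2 * a * t)) t : ℂ)
          * RCLike.map 𝕜 ℂ (weightedDensity ρ τ (2 * a * t))) := by
  set q := logDistRegular fun t => ρ (2 * a * t) with hqdef
  set g : ℝ → ℂ := fun t => RCLike.map 𝕜 ℂ (weightedDensity ρ τ (2 * a * t)) with hg
  have hgc : Continuous g := (RCLike.map 𝕜 ℂ).continuous.comp (by fun_prop)
  have ha' : 2 * a ≠ 0 := by positivity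
  have h1 : RCLike.map 𝕜 ℂ (laplaceSLP a ρ τ)
      = ∫ x in (-a)..a, RCLike.map 𝕜 ℂ (laplaceIntegrand ρ τ x) :=
    ((RCLike.map 𝕜 ℂ).intervalIntegral_comp_comm
      (intervalIntegrable_laplaceIntegrand ha hq hτc)).symm
  have h2 := intervalIntegral.integral_comp_mul_left (a := -(1 / 2)) (b := -(1 / 2) + 1)
    (fun x => RCLike.map 𝕜 ℂ (laplaceIntegrand ρ τ x)) ha'
  rw [show 2 * a * (-(1 / 2)) = -a by ring, show 2 * a * (-(1 / 2) + 1) = a by ring, ← h1] at h2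
  have h3 : ∫ t in (-(1 / 2) : ℝ)..(-(1 / 2) + 1),
      RCLike.map 𝕜 ℂ (laplaceIntegrand ρ τ (2 * a * t))
      = ∫ t in (-(1 / 2) : ℝ)..(-(1 / 2) + 1), ((logKernel t : ℂ) - (q t : ℂ)) * g t := by
    refine intervalIntegral.integral_congr_ae ?_
    have h0 : ∀ᵐ x : ℝ, x ∉ ({0} : Set ℝ) := (Set.countable_singleton 0).ae_notMem _
    filter_upwards [h0] with t ht hta
    rw [Set.uIoc_of_le (by linarith)] at hta
    exact laplaceIntegrand_two_mul a ρ τ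
      (sin_pi_mul_ne_zero_of_abs_le (abs_le.2 ⟨hta.1.le, by linarith [hta.2]⟩) ht)
  have hper : Function.Periodic (fun t => ((logKernel t : ℂ) - (q t : ℂ)) * g t) 1 := fun t => by
    have e1 : q (t + 1) = q t := logDistRegular_periodic hρ t
    have e2 : g (t + 1) = g t := congrArg (RCLike.map 𝕜 ℂ) (hτ t)
    show ((logKernel (t + 1) : ℂ) - (q (t + 1) : ℂ)) * g (t + 1) = _
    rw [e1, e2, logKernel_periodic]
  have hi1 : IntervalIntegrable (fun t => (logKernel t : ℂ) * g t) MeasureTheory.volume 0 1 :=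
    (intervalIntegrable_logKernel 0 1).complex_ofReal.mul_continuousOn hgc.continuousOn
  have hi2 : IntervalIntegrable (fun t => (q t : ℂ) * g t) MeasureTheory.volume 0 1 :=
    Continuous.intervalIntegrable (by fun_prop) _ _
  rw [h3, hper.intervalIntegral_add_eq _ 0, zero_add] at h2
  simp only [sub_mul] at h2
  rw [intervalIntegral.integral_sub hi1 hi2, Complex.real_smul] at h2
  rw [h2]
  have : (a : ℂ) ≠ 0 := by exact_mod_cast ha.ne'
  push_cast
  field_simp

theorem map_correctedRule {n : ℕ} {𝕜 : Type*} [RCLike 𝕜] (a : ℝ)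
    (ρ : ℝ → EuclideanSpace ℝ (Fin n)) (τ : ℝ → 𝕜) {K : ℕ} (w : Fin (K + 1) → ℝ) (M : ℕ) :
    RCLike.map 𝕜 ℂ (correctedRule a ρ τ w M) =
      2 * a / (2 * M + 1) * ((∑ m ∈ puncturedIndices M, (logKernel (m / (2 * M + 1)) : ℂ)
          * RCLike.map 𝕜 ℂ (weightedDensity ρ τ (2 * a * (m / (2 * M + 1)))))
        - (∑ m ∈ puncturedIndices M,
          (logDistRegular (fun t => ρ (2 * a * t)) (m / (2 * M + 1)) : ℂ)
          * RCLike.map 𝕜 ℂ (weightedDensity ρ τ (2 * a * (m / (2 * M + 1)))))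
        - (Real.log (‖deriv ρ 0‖ * gridStep a M) : ℂ)
          * RCLike.map 𝕜 ℂ (weightedDensity ρ τ (2 * a * 0))
        + ∑ j : Fin (K + 1), (w j : ℂ)
          * (RCLike.map 𝕜 ℂ (weightedDensity ρ τ (2 * a * (j / (2 * M + 1))))
            + RCLike.map 𝕜 ℂ (weightedDensity ρ τ (2 * a * (-(j / (2 * M + 1))))))) := by
  have hh : (gridStep a M : ℂ) = 2 * a / (2 * M + 1) := by
    rw [gridStep_eq]; push_cast; rfl
  have hmul (x : ℝ) : x * gridStep a M = 2 * a * (x / (2 * M + 1)) := by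
    rw [gridStep_eq]; ring
  rw [correctedRule, puncturedTrapezoid, map_add, map_sub, ← smul_sum, map_smul, map_smul,
    map_smul, map_sum, map_sum, mul_zero, ← sum_sub_distrib]
  simp only [map_smul, map_add, hmul, ← mul_neg, Complex.real_smul]
  rw [sum_congr rfl fun m hm =>
    (laplaceIntegrand_two_mul a ρ τ (sin_pi_mul_div_ne_zero hm)).trans (sub_mul _ _ _)]
  rw [Complex.ofReal_mul, ← hh]
  ring

theorem map_laplaceSLP_sub_correctedRule {n : ℕ} {𝕜 : Type*} [RCLike 𝕜] {a : ℝ} (ha : 0 < a)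
    {ρ : ℝ → EuclideanSpace ℝ (Fin n)} {τ : ℝ → 𝕜} (hreg : deriv ρ 0 ≠ 0)
    (hρ : Function.Periodic (fun t => ρ (2 * a * t)) 1)
    (hτ : Function.Periodic (fun t => weightedDensity ρ τ (2 * a * t)) 1)
    (hq : Continuous (logDistRegular fun t => ρ (2 * a * t)))
    (hτc : Continuous (weightedDensity ρ τ)) {K : ℕ} (w : Fin (K + 1) → ℝ) (M : ℕ) :
    RCLike.map 𝕜 ℂ (laplaceSLP a ρ τ - correctedRule a ρ τ w M) =
      2 * a * (logRuleDefect w (fun t => RCLike.map 𝕜 ℂ (weightedDensity ρ τ (2 * a * t))) M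
        - trapezoidDefect (fun t => (logDistRegular (fun t => ρ (2 * a * t)) t : ℂ)
          * RCLike.map 𝕜 ℂ (weightedDensity ρ τ (2 * a * t))) M) := by
  have hpi := Real.pi_pos
  have hN : (0 : ℝ) < 2 * M + 1 := by positivity
  have hr : 0 < ‖deriv ρ 0‖ := norm_pos_iff.2 hreg
  have hlog : Real.log (‖deriv ρ 0‖ * gridStep a M) =
      logDistRegular (fun t => ρ (2 * a * t)) 0 - (Real.log (2 * M + 1) - Real.log (2 * Real.pi)) := by
    have hd : deriv (fun t => ρ (2 * a * t)) 0 = (2 * a) • deriv ρ 0 := by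
      simpa using deriv_comp_mul_left (2 * a) ρ 0
    rw [logDistRegular_zero, hd, norm_smul, Real.norm_of_nonneg (by positivity), gridStep_eq,
      Real.log_div (by positivity) (by positivity), ← mul_div_assoc,
      Real.log_div (by positivity) (by positivity), mul_comm ‖deriv ρ 0‖]
    ring
  rw [map_sub, map_laplaceSLP ha hρ hτ hq hτc, map_correctedRule, logRuleDefect, trapezoidDefect,
    hlog]
  push_cast
  ring

end

theorem mainTheorem3 {𝕜 : Type*} [RCLike 𝕜] {n : ℕ} (K : ℕ) (a : ℝ) (ha : 0 < a)
    (ρ : ℝ → EuclideanSpace ℝ (Fin n))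
    (hρ_smooth : ContDiff ℝ ∞ ρ)
    (hρ_periodic : Function.Periodic ρ (2 * a))
    (hρ_regular : deriv ρ 0 ≠ 0)
    (hρ_simple : ∀ x ∈ Set.Icc (-a) a, ρ x = ρ 0 → x = 0)
    (τ : ℝ → 𝕜)
    (hτ_periodic : Function.Periodic τ (2 * a))
    (hτ_smooth : ContDiff ℝ ∞ (weightedDensity ρ τ)) :
    (∃! w : Fin (K + 1) → ℝ, IsLogCorrectionWeights K w) ∧
    IntervalIntegrable (laplaceIntegrand ρ τ) MeasureTheory.volume (-a) a ∧
    ∀ w : Fin (K + 1) → ℝ, IsLogCorrectionWeights K w →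
      (fun M : ℕ => laplaceSLP a ρ τ - correctedRule a ρ τ w M)
        =O[Filter.atTop] (fun M : ℕ => gridStep a M ^ (2 * K + 2)) := by
  have ha2 : 2 * a ≠ 0 := by positivity
  have hσper := hρ_periodic.comp_mul_left_one
  have hgper := (weightedDensity_periodic hρ_periodic hτ_periodic).comp_mul_left_one
  have hσ : ContDiff ℝ ∞ fun t => ρ (2 * a * t) := hρ_smooth.comp (by fun_prop)
  have hq : ContDiff ℝ ∞ (logDistRegular fun t => ρ (2 * a * t)) := by
    refine contDiff_logDistRegular hσ hσper ?_ fun t ht h => ?_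
    · have hd : deriv (fun t => ρ (2 * a * t)) 0 = (2 * a) • deriv ρ 0 := by
        simpa using deriv_comp_mul_left (2 * a) ρ 0
      rw [hd]
      exact smul_ne_zero ha2 hρ_regular
    · rw [mul_zero] at h
      have ht' := abs_le.1 ht
      have := hρ_simple (2 * a * t) ⟨by nlinarith, by nlinarith⟩ h
      exact (mul_eq_zero.1 this).resolve_left ha2
  set g : ℝ → ℂ := fun t => RCLike.map 𝕜 ℂ (weightedDensity ρ τ (2 * a * t)) with hgdef
  have hg : ContDiff ℝ ∞ g := (RCLike.map 𝕜 ℂ).contDiff.comp (hτ_smooth.comp (by fun_prop))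
  have hgper' : Function.Periodic g 1 := fun t => congrArg (RCLike.map 𝕜 ℂ) (hgper t)
  have hqg : ContDiff ℝ ∞ fun t => (logDistRegular (fun t => ρ (2 * a * t)) t : ℂ) * g t :=
    (Complex.ofRealCLM.contDiff.comp hq).mul hg
  have hqgper : Function.Periodic
      (fun t => (logDistRegular (fun t => ρ (2 * a * t)) t : ℂ) * g t) 1 := fun t => by
    show (logDistRegular (fun t => ρ (2 * a * t)) (t + 1) : ℂ) * g (t + 1) = _
    rw [logDistRegular_periodic hσper, hgper']
  refine ⟨existsUnique_isLogCorrectionWeights K,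
    intervalIntegrable_laplaceIntegrand ha hq.continuous hτ_smooth.continuous, fun w hw => ?_⟩
  obtain ⟨C₁, hC₁⟩ := exists_norm_logRuleDefect_le hw hg hgper'
  obtain ⟨C₂, hC₂⟩ := exists_norm_trapezoidDefect_le hqg hqgper (2 * K + 3)
  have hC0 : 0 ≤ C₁ + C₂ := by
    have h1 := (norm_nonneg _).trans (hC₁ 0)
    have h2 := (norm_nonneg _).trans (hC₂ 0)
    simp only [CharP.cast_eq_zero, mul_zero, zero_add, one_pow, div_one] at h1 h2
    positivity
  refine Asymptotics.IsBigO.of_bound (2 * a * (C₁ + C₂) / (2 * a) ^ (2 * K + 2))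
    (Filter.Eventually.of_forall fun M => ?_)
  have hN1 : (1 : ℝ) ≤ 2 * M + 1 := by linarith [M.cast_nonneg (α := ℝ)]
  have hN : (0 : ℝ) < 2 * M + 1 := by linarith
  rw [← RCLike.norm_map_complex, map_laplaceSLP_sub_correctedRule ha hρ_regular hσper hgper
    hq.continuous hτ_smooth.continuous, norm_mul, gridStep_eq, Real.norm_of_nonneg (by positivity),
    div_pow]
  have h2a : ‖(2 * a : ℂ)‖ = 2 * a := by simp [abs_of_pos ha]
  rw [h2a]
  calc 2 * a * ‖_‖ ≤ 2 * a * ((C₁ + C₂) / (2 * M + 1) ^ (2 * K + 3)) := by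
        gcongr
        refine (norm_sub_le _ _).trans ?_
        rw [add_div]
        exact add_le_add (hC₁ M) (hC₂ M)
    _ ≤ 2 * a * ((C₁ + C₂) / (2 * M + 1) ^ (2 * K + 2)) := by
        gcongr
        norm_num
    _ = _ := by field_simp
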